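/- Let $D\ge 0$ and $\gamma>D$. Consider the closed-loop system on $\mathbb{R}^2$ $$\dot x_1=x_2,\qquad \dot x_2=-\gamma\,\mathrm{sign}(x_1)-\delta(x)+d(t),\qquad \delta(x)=\begin{cases}|x_2|\,|x_1|^{-1}x_2,& x_1x_2<0,\\ 0,&\text{otherwise,}\end{cases}$$ where the disturbance $d$ is Lebesgue measurable on $[0,\infty)$ with $\operatorname{ess\,sup}_{t\ge 0}|d(t)|\le D$. Solutions are understood in the sense of Filippov: $x$ is absolutely continuous on compact time intervals and satisfies the system for almost every $t$, where $\mathrm{sign}(0)$ may take any value in $[-1,1]$. A trajectory is a solution on $[0,\infty)$. The problem is called well-posed from $x_0$ if there is a trajectory with $x(0)=x_0$ and every solution on an interval $[0,T]$ with the same initial value coincides with it there. Let $U=\{x\in\mathbb{R}^2: x_1x_2\ge 0\}$ and $C=\{x\in\mathbb{R}^2: x_1x_2<0\}$. The origin is called uniformly finite-time attractive on a set $S$ if for every $r>0$ there is $T\ge 0$ such that $x(t)=0$ for all $t\ge T$, for every trajectory with $x(0)\in S$, $|x(0)|\le r$ and every disturbance $d$ as above. 1. For every such $d$ and every $x_0\in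 U\setminus\{0\}$, the problem is well-posed from $x_0$, and any trajectory with $x(0)=x_0$ leaves $U$ in finite time: there is $T_U\ge 0$ such that $x(t)\in U$ for $t\in[0,T_U]$, $x(t)\in C$ for all $t$ in some interval $(T_U,T_U+\varepsilon)$ with $\varepsilon>0$, and $$\frac{|x_2(0)|}{\gamma+D}\le T_U\le\frac{|x_2(0)|}{\gamma-D}.$$ 2. If moreover $\gamma>D^{1.5}+D+\tfrac12$, then (a) for every such $d$ the problem is well-posed from every $x_0\in C\cup\{0\}$; (b) $C\cup\{0\}$ is forward invariant: for every such $d$, every trajectory with $x(0)\in C\cup\{0\}$ satisfies $x(t)\in C\cup\{0\}$ for all $t\ge 0$; (c) the origin is stable for initial states in $C\cup\{0\}$, uniformly in $d$: for every $\varepsilon>0$ there is $\eta>0$ such that $|x(t)|\le\varepsilon$ for all $t\ge0$, for every such $d$ and every trajectory with $x(0)\in C\cup\{0\}$ and $|x(0)|\le\eta$; and the origin is uniformly finite-time attractive on $C\cup\{0\}$; (d) the origin is uniformly globally finite-time attractive, i.e. uniformly finite-time attractive on $\mathbb{R}^2$. -/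

import Mathlib

open Set MeasureTheory

namespace QuasiContControl

/-- The undamped set: first and third quadrants, axes included. States are `x = (x₁, x₂)`. -/
def U : Set (ℝ × ℝ) := {x | 0 ≤ x.1 * x.2}

/-- The convergence set: open second and fourth quadrants. -/
def C : Set (ℝ × ℝ) := {x | x.1 * x.2 < 0}

/-- The set-valued sign of sliding mode control: `{sign z}` for `z ≠ 0` and `[-1, 1]` at `z = 0`. -/
noncomputable def setSign (z : ℝ) : Set ℝ := if z = 0 then Icc (-1) 1 else {Real.sign z}

/-- The nonlinear damping term `δ`. -/
noncomputable def damping (x : ℝ × ℝ) : ℝ :=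
  if x.1 * x.2 < 0 then |x.2| * |x.1|⁻¹ * x.2 else 0

/-- The admissible values of the feedback control `u = -γ sign(x₁) - δ` in the state `x`. -/
def control (γ : ℝ) (x : ℝ × ℝ) : Set ℝ := {u | ∃ s ∈ setSign x.1, u = -γ * s - damping x}

/-- Disturbances: Lebesgue measurable on `[0, ∞)`, with essential supremum of `|d|` at most `D`. -/
structure IsDisturbance (D : ℝ) (d : ℝ → ℝ) : Prop where
  measurable : AEMeasurable d (volume.restrict (Ici 0))
  bound : ∀ᵐ t ∂(volume.restrict (Ici (0 : ℝ))), |d t| ≤ D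

/-- Solutions of the closed loop `x₁' = x₂`, `x₂' = u + d` on `[0, T]` (in the sense of Filippov):
absolutely continuous functions satisfying the inclusion for almost every time. -/
structure IsSolutionOn (γ : ℝ) (d : ℝ → ℝ) (T : ℝ) (x : ℝ → ℝ × ℝ) : Prop where
  absCont_fst : AbsolutelyContinuousOnInterval (fun t => (x t).1) 0 T
  absCont_snd : AbsolutelyContinuousOnInterval (fun t => (x t).2) 0 T
  ode : ∀ᵐ t ∂(volume.restrict (Icc 0 T)),
    HasDerivAt (fun s => (x s).1) (x t).2 t ∧
      ∃ u ∈ control γ (x t), HasDerivAt (fun s => (x s).2) (u + d t) t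

/-- Trajectories: solutions on the whole of `[0, ∞)`. -/
def IsTrajectory (γ : ℝ) (d : ℝ → ℝ) (x : ℝ → ℝ × ℝ) : Prop :=
  ∀ T : ℝ, 0 < T → IsSolutionOn γ d T x

/-- Well-posedness from `x₀`: there is a trajectory starting in `x₀`, and every solution on a
bounded interval `[0, T]` starting in `x₀` is a restriction of it. -/
def WellPosedFrom (γ : ℝ) (d : ℝ → ℝ) (x₀ : ℝ × ℝ) : Prop :=
  ∃ x, IsTrajectory γ d x ∧ x 0 = x₀ ∧
    ∀ (T : ℝ) (y : ℝ → ℝ × ℝ), 0 < T → IsSolutionOn γ d T y → y 0 = x₀ → EqOn y x (Icc 0 T)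

/-- `T` is the time of leaving `U`: the trajectory is in `U` during `[0, T]`, and outside `U`
(that is, in `C`) immediately after `T`. -/
def LeavesUAt (x : ℝ → ℝ × ℝ) (T : ℝ) : Prop :=
  0 ≤ T ∧ (∀ t ∈ Icc 0 T, x t ∈ U) ∧ ∃ ε > 0, ∀ t ∈ Ioo T (T + ε), x t ∈ C

/-- Forward invariance of `S` for all disturbances bounded by `D`. -/
def ForwardInvariant (γ D : ℝ) (S : Set (ℝ × ℝ)) : Prop :=
  ∀ d, IsDisturbance D d → ∀ x, IsTrajectory γ d x → x 0 ∈ S → ∀ t, 0 ≤ t → x t ∈ S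

/-- Stability of the origin for initial states in `S`, uniformly in the disturbance. -/
def UniformlyStableOn (γ D : ℝ) (S : Set (ℝ × ℝ)) : Prop :=
  ∀ ε > 0, ∃ η > 0, ∀ d, IsDisturbance D d → ∀ x, IsTrajectory γ d x → x 0 ∈ S → ‖x 0‖ ≤ η →
    ∀ t, 0 ≤ t → ‖x t‖ ≤ ε

/-- Uniform finite-time attractiveness of the origin for initial states in `S`: for each `r` a
single finite time serves for all initial states in `S` of norm at most `r` and all disturbances. -/
def UniformlyFiniteTimeAttractiveOn (γ D : ℝ) (S : Set (ℝ × ℝ)) : Prop :=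
  ∀ r > 0, ∃ T, 0 ≤ T ∧ ∀ d, IsDisturbance D d → ∀ x, IsTrajectory γ d x → x 0 ∈ S → ‖x 0‖ ≤ r →
    ∀ t, T ≤ t → x t = 0

end QuasiContControl

/-!
The system is odd, and the plane is the disjoint union of the origin, the half-plane `RightHalf`
(`x₁ > 0`, or `x₁ = 0 < x₂`) and its negative. In the right half-plane the closed loop reads
`x₁' = x₂`, `x₂' = -γ + min(x₂, 0)² / x₁ + d`.

*Barriers.* In the fourth quadrant the ratio `w = x₂² / x₁` satisfies
`w' = |x₂| / x₁ * (2 (γ - d) - w)`, so that the parabolas `x₂² = K x₁` with `K ≥ 2 (γ + D)` cannot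
be crossed towards larger `w` (`Arc.min_sq_le`). Hence a trajectory leaves the right half-plane only through the origin
(`Arc.pos_of_mem_rightHalf`). No trajectory can leave the origin (`Arc.eq_zero`): it would stay
in one of the two half-planes, say the right one, where `x₂' ≤ -γ + D < 0` as long as `x₂ > 0`;
so `x₂ ≤ 0`, and `x₁` could not increase from zero. Stability follows from the barriers and from the
monotonicity of `x₁` in the fourth quadrant (`Arc.fourth_quadrant`).

*Durations.* In the first quadrant `x₂` decreases at a rate between `γ - D` and `γ + D`, so that
`x₂ = 0` is reached in time (`Arc.exists_turn`), and the trajectory turns into the fourth quadrant,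
since the damping is negligible near `x₂ = 0 < x₁` (`Arc.snd_neg`). In the fourth quadrant, with
`m = (γ - D) / 2`, the speed grows at least at the rate `m` until `x₂² ≥ m x₁`, which then
persists and makes `√x₁` decrease at least at the rate `√m / 2` (`Arc.descent_time_le`).

*Well-posedness.* Uniqueness (`Arc.eqOn`) is proved by continuous induction: locally in the
half-planes by Grönwall's inequality, where the disturbance cancels in the difference of two
solutions, and at the origin because it is never left. For local existence, subtracting a primitive
of the disturbance from `x₂` yields a vector field that is continuous in time, to which the
Picard-Lindelöf theorem applies after a cutoff (`exists_arc_of_mem_rightHalf`). The barriers bound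
the acceleration, so that a solution away from the origin extends to any bounded interval, and a
solution that reaches the origin continues by zero (`exists_arc_Icc`).
-/

namespace QuasiContControl

/-! ### Absolutely continuous functions with one-sided derivative bounds -/

/-- An absolutely continuous function whose derivative is at most `c` almost everywhere grows at
most at the rate `c`. -/
lemma sub_le_of_ae_hasDerivAt_le {f : ℝ → ℝ} {a b c : ℝ} (hab : a ≤ b)
    (hf : AbsolutelyContinuousOnInterval f a b)
    (h : ∀ᵐ t, t ∈ Ioo a b → ∃ v ≤ c, HasDerivAt f v t) : f b - f a ≤ c * (b - a) := by
  rw [← hf.integral_deriv_eq_sub]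
  have hc : ∫ _ in a..b, c = c * (b - a) := by simp [mul_comm]
  rw [← hc]
  apply intervalIntegral.integral_mono_ae_restrict hab hf.intervalIntegrable_deriv (by simp)
  rw [Filter.EventuallyLE, ← Measure.restrict_congr_set Ioo_ae_eq_Icc,
    ae_restrict_iff' measurableSet_Ioo]
  filter_upwards [h] with t ht hm
  obtain ⟨v, hv, hd⟩ := ht hm
  rw [hd.deriv]; exact hv

/-- Lower version of `sub_le_of_ae_hasDerivAt_le`. -/
lemma le_sub_of_ae_le_hasDerivAt {f : ℝ → ℝ} {a b c : ℝ} (hab : a ≤ b)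
    (hf : AbsolutelyContinuousOnInterval f a b)
    (h : ∀ᵐ t, t ∈ Ioo a b → ∃ v, c ≤ v ∧ HasDerivAt f v t) : c * (b - a) ≤ f b - f a := by
  have := sub_le_of_ae_hasDerivAt_le (c := -c) hab hf.fun_neg (by
    filter_upwards [h] with t ht hm
    obtain ⟨v, hv, hd⟩ := ht hm
    exact ⟨-v, by linarith, hd.fun_neg⟩)
  linarith

/-- A continuous function that does not increase along any interval on which it exceeds the level
`c` cannot rise above that level. -/
lemma le_of_barrier {f : ℝ → ℝ} {a b c : ℝ} (hf : ContinuousOn f (Icc a b)) (ha : f a ≤ c)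
    (h : ∀ s t, a ≤ s → s ≤ t → t ≤ b → (∀ τ ∈ Icc s t, c < f τ) → f t ≤ f s) :
    ∀ t ∈ Icc a b, f t ≤ c := by
  intro t ht
  by_contra! hlt
  -- `s` is the last time up to `t` at which `f ≤ c`
  have hfc : ContinuousOn f (Icc a t) := hf.mono (Icc_subset_Icc_right ht.2)
  have hK : IsCompact (Icc a t ∩ f ⁻¹' Iic c) :=
    isCompact_Icc.of_isClosed_subset (hfc.preimage_isClosed_of_isClosed isClosed_Icc isClosed_Iic)
      inter_subset_left
  obtain ⟨s, ⟨⟨hs1, hs2⟩, hs3⟩, hs4⟩ := hK.exists_isGreatest ⟨a, ⟨le_rfl, ht.1⟩, ha⟩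
  have hs3 : f s ≤ c := hs3
  have hst : s < t := lt_of_le_of_ne hs2 (by rintro rfl; linarith)
  have hgt : ∀ τ ∈ Ioc s t, c < f τ := by
    intro τ hτ
    by_contra! hle
    exact absurd (hs4 ⟨⟨hs1.trans hτ.1.le, hτ.2⟩, hle⟩) (not_le.2 hτ.1)
  have hlim : Filter.Tendsto f (nhdsWithin s (Ioc s t)) (nhds (f s)) :=
    (hf s ⟨hs1, hs2.trans ht.2⟩).mono
      (fun τ hτ => ⟨hs1.trans hτ.1.le, hτ.2.trans ht.2⟩)
  rw [nhdsWithin_Ioc_eq_nhdsGT hst] at hlim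
  have : f t ≤ f s := by
    refine ge_of_tendsto hlim ?_
    filter_upwards [Ioc_mem_nhdsGT hst] with σ hσ
    exact h σ t (hs1.trans hσ.1.le) hσ.2 ht.2
      (fun τ hτ => hgt τ ⟨hσ.1.trans_le hτ.1, hτ.2⟩)
  linarith

/-- The barrier principle for absolutely continuous functions. -/
lemma le_of_ae_barrier {f : ℝ → ℝ} {a b c : ℝ} (hab : a ≤ b)
    (hf : AbsolutelyContinuousOnInterval f a b) (ha : f a ≤ c)
    (h : ∀ᵐ t, t ∈ Ioo a b → c < f t → ∃ v ≤ 0, HasDerivAt f v t) : ∀ t ∈ Icc a b, f t ≤ c := by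
  refine le_of_barrier (uIcc_of_le hab ▸ hf.continuousOn) ha (fun s t has hst htb hgt => ?_)
  have := sub_le_of_ae_hasDerivAt_le (c := 0) hst
    (hf.mono (by rw [uIcc_of_le hst, uIcc_of_le hab]; exact Icc_subset_Icc has htb)) (by
      filter_upwards [h] with τ hτ hm
      exact hτ ⟨has.trans_lt hm.1, hm.2.trans_le htb⟩ (hgt τ (Ioo_subset_Icc_self hm)))
  linarith

/-- The first zero of a continuous function that is positive just after `a`. -/
lemma exists_first_zero {f : ℝ → ℝ} {a b h : ℝ} (hf : ContinuousOn f (Icc a b))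
    (hh : a < h) (hpos : ∀ t ∈ Ioo a h, 0 < f t) (hab : a < b) (hb : f b ≤ 0) :
    ∃ s ∈ Ioc a b, f s = 0 ∧ ∀ t ∈ Ioo a s, 0 < f t := by
  obtain ⟨c, hc1, hc2⟩ : ∃ c, a < c ∧ c < min h b := exists_between (lt_min hh hab)
  have hch := hc2.trans_le (min_le_left _ _)
  have hcb := hc2.trans_le (min_le_right _ _)
  have hfc : ContinuousOn f (Icc c b) := hf.mono (Icc_subset_Icc_left hc1.le)
  have hK : IsCompact (Icc c b ∩ f ⁻¹' Iic 0) :=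
    isCompact_Icc.of_isClosed_subset (hfc.preimage_isClosed_of_isClosed isClosed_Icc isClosed_Iic)
      inter_subset_left
  obtain ⟨s, ⟨⟨hs1, hs2⟩, hs3⟩, hs4⟩ := hK.exists_isLeast ⟨b, ⟨hcb.le, le_rfl⟩, hb⟩
  have hs3 : f s ≤ 0 := hs3
  have hgt : ∀ τ ∈ Ioo a s, 0 < f τ := by
    intro τ hτ
    by_contra! hle
    rcases lt_or_ge τ c with h1 | h1
    · exact absurd (hpos τ ⟨hτ.1, h1.trans hch⟩) (not_lt.2 hle)
    · exact absurd (hs4 ⟨⟨h1, hτ.2.le.trans hs2⟩, hle⟩) (not_le.2 hτ.2)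
  have has : a < s := hc1.trans_le hs1
  refine ⟨s, ⟨has, hs2⟩, le_antisymm hs3 ?_, hgt⟩
  have hlim : Filter.Tendsto f (nhdsWithin s (Ioo a s)) (nhds (f s)) :=
    (hf s ⟨has.le, hs2⟩).mono (fun τ hτ => ⟨hτ.1.le, hτ.2.le.trans hs2⟩)
  rw [nhdsWithin_Ioo_eq_nhdsLT has] at hlim
  refine ge_of_tendsto hlim ?_
  filter_upwards [Ioo_mem_nhdsLT has] with σ hσ
  exact (hgt σ hσ).le

/-- Absolute continuity only depends on the values on the interval. -/
lemma absolutelyContinuousOnInterval_congr {f g : ℝ → ℝ} {a b : ℝ}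
    (hf : AbsolutelyContinuousOnInterval f a b) (h : EqOn g f (uIcc a b)) :
    AbsolutelyContinuousOnInterval g a b := by
  rw [absolutelyContinuousOnInterval_iff] at hf ⊢
  intro ε hε
  obtain ⟨δ, hδ, H⟩ := hf ε hε
  refine ⟨δ, hδ, fun E hE hlt => ?_⟩
  have hE' := hE.1
  convert! H E hE hlt using 2 with i hi
  rw [h (hE' i hi).1, h (hE' i hi).2]

/-- Two absolutely continuous functions that agree at the common end point of their intervals
can be concatenated. -/
lemma absolutelyContinuousOnInterval_concat {f g : ℝ → ℝ} {a b c : ℝ} (hab : a ≤ b) (hbc : b ≤ c)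
    (hf : AbsolutelyContinuousOnInterval f a b) (hg : AbsolutelyContinuousOnInterval g b c)
    (hfg : f b = g b) :
    AbsolutelyContinuousOnInterval (fun t => if t ≤ b then f t else g t) a c := by
  set φ : ℝ → ℝ := fun t => if t ≤ b then deriv f t else deriv g t with hφ
  have e1 : ∀ {s t}, s ≤ t → t ≤ b → EqOn (deriv f) φ (Ioo s t) := fun _ htb τ hτ => by
    simp [hφ, hτ.2.le.trans htb]
  have e2 : ∀ {t}, b ≤ t → EqOn (deriv g) φ (Ioo b t) := fun _ τ hτ => by
    simp [hφ, not_le.2 hτ.1]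
  have i1 : IntervalIntegrable φ volume a b :=
    hf.intervalIntegrable_deriv.congr_uIoo (by rw [uIoo_of_le hab]; exact e1 hab le_rfl)
  have i2 : IntervalIntegrable φ volume b c :=
    hg.intervalIntegrable_deriv.congr_uIoo (by rw [uIoo_of_le hbc]; exact e2 hbc)
  have i3 := (i1.trans i2).absolutelyContinuousOnInterval_intervalIntegral (c := a) (by simp)
  have key1 : ∀ t ∈ Icc a b, ∫ τ in a..t, φ τ = f t - f a := by
    intro t ht
    have hm : AbsolutelyContinuousOnInterval f a t := hf.mono (by
      rw [uIcc_of_le ht.1, uIcc_of_le hab]; exact Icc_subset_Icc_right ht.2)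
    rw [← hm.integral_deriv_eq_sub]
    exact (intervalIntegral.integral_congr_uIoo (by
      rw [uIoo_of_le ht.1]; exact e1 ht.1 ht.2)).symm
  have key2 : ∀ t ∈ Icc b c, ∫ τ in b..t, φ τ = g t - g b := by
    intro t ht
    have hm : AbsolutelyContinuousOnInterval g b t := hg.mono (by
      rw [uIcc_of_le ht.1, uIcc_of_le hbc]; exact Icc_subset_Icc_right ht.2)
    rw [← hm.integral_deriv_eq_sub]
    exact (intervalIntegral.integral_congr_uIoo (by
      rw [uIoo_of_le ht.1]; exact e2 ht.1)).symm
  have hconst : AbsolutelyContinuousOnInterval (fun _ : ℝ => f a) a c :=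
    (LipschitzWith.const (f a)).lipschitzOnWith.absolutelyContinuousOnInterval
  refine absolutelyContinuousOnInterval_congr (hconst.fun_add i3) ?_
  rw [uIcc_of_le (hab.trans hbc)]
  intro t ht
  by_cases htb : t ≤ b
  · simp only [htb, if_true]
    rw [key1 t ⟨ht.1, htb⟩]; ring
  · simp only [htb, if_false]
    have hbt := (not_le.1 htb).le
    have hsub : uIcc b t ⊆ uIcc b c := by
      rw [uIcc_of_le hbt, uIcc_of_le hbc]; exact Icc_subset_Icc_right ht.2
    rw [← intervalIntegral.integral_add_adjacent_intervals i1 (i2.mono_set hsub),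
      key1 b ⟨hab, le_rfl⟩, key2 t ⟨hbt, ht.2⟩, hfg]
    ring

/-! ### Solutions on an interval -/

/-- `x` solves the closed loop on `[a, b]`, and the disturbance is bounded by `D` there. The
differential inclusion is only required at almost every interior time, so that the end points
never matter. -/
structure Arc (γ D : ℝ) (d : ℝ → ℝ) (a b : ℝ) (x : ℝ → ℝ × ℝ) : Prop where
  fst : AbsolutelyContinuousOnInterval (fun t => (x t).1) a b
  snd : AbsolutelyContinuousOnInterval (fun t => (x t).2) a b
  ode : ∀ᵐ t, t ∈ Ioo a b → HasDerivAt (fun s => (x s).1) (x t).2 t ∧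
    (∃ u ∈ control γ (x t), HasDerivAt (fun s => (x s).2) (u + d t) t) ∧ |d t| ≤ D

/-- The damping force in the right half-plane `{x₁ > 0}`, in a form that is continuous across
`x₂ = 0`. -/
noncomputable def brake (p : ℝ × ℝ) : ℝ := (min p.2 0) ^ 2 / p.1

/-- The half-plane `x₁ > 0` together with the half-axis `x₁ = 0 < x₂` of its boundary through which
trajectories enter it. This set, its negative and the origin partition the plane. -/
def RightHalf : Set (ℝ × ℝ) := {p | 0 < p.1 ∨ p.1 = 0 ∧ 0 < p.2}

lemma eq_zero_or_mem_rightHalf (p : ℝ × ℝ) : p = 0 ∨ p ∈ RightHalf ∨ -p ∈ RightHalf := by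
  rcases p with ⟨p, q⟩
  simp only [Prod.mk_eq_zero, RightHalf, mem_ofPred_eq, Prod.neg_mk]
  rcases lt_trichotomy p 0 with h | h | h
  · right; right; left; linarith
  · rcases lt_trichotomy q 0 with h' | h' | h'
    · right; right; right; exact ⟨by linarith, by linarith⟩
    · left; exact ⟨h, h'⟩
    · right; left; right; exact ⟨h, h'⟩
  · right; left; left; exact h

lemma neg_mem_control {γ : ℝ} {p : ℝ × ℝ} {u : ℝ} (h : u ∈ control γ p) : -u ∈ control γ (-p) := by
  obtain ⟨s, hs, rfl⟩ := h
  refine ⟨-s, ?_, ?_⟩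
  · unfold setSign at hs ⊢
    simp only [Prod.fst_neg, neg_eq_zero]
    split_ifs at hs ⊢ with h0
    · exact ⟨by linarith [hs.2], by linarith [hs.1]⟩
    · rw [mem_singleton_iff] at hs ⊢
      rw [hs]
      rcases lt_or_gt_of_ne h0 with h1 | h1
      · rw [Real.sign_of_neg h1, Real.sign_of_pos (by linarith)]; norm_num
      · rw [Real.sign_of_pos h1, Real.sign_of_neg (by linarith)]
  · unfold damping
    simp only [Prod.fst_neg, Prod.snd_neg, neg_mul_neg, abs_neg]
    split_ifs <;> ring

lemma mem_control_iff_of_pos {γ : ℝ} {p : ℝ × ℝ} {u : ℝ} (hp : 0 < p.1) :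
    u ∈ control γ p ↔ u = -γ + brake p := by
  have hd : damping p = -brake p := by
    unfold damping brake
    split_ifs with h
    · have h2 : p.2 < 0 := by by_contra! h2; exact absurd h (not_lt.2 (mul_nonneg hp.le h2))
      rw [min_eq_left h2.le, abs_of_neg h2, abs_of_pos hp]; ring
    · have h2 : 0 ≤ p.2 := by by_contra! h2; exact h (mul_neg_of_pos_of_neg hp h2)
      rw [min_eq_right h2]; simp
  simp [control, setSign, hp.ne', Real.sign_of_pos hp, hd]

lemma brake_nonneg {p : ℝ × ℝ} (hp : 0 ≤ p.1) : 0 ≤ brake p := by unfold brake; positivity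

lemma brake_of_nonneg {p : ℝ × ℝ} (hp : 0 ≤ p.2) : brake p = 0 := by
  simp [brake, min_eq_right hp]

lemma brake_of_nonpos {p : ℝ × ℝ} (hp : p.2 ≤ 0) : brake p = p.2 ^ 2 / p.1 := by
  simp [brake, min_eq_left hp]

namespace Arc

variable {γ D a b : ℝ} {d : ℝ → ℝ} {x : ℝ → ℝ × ℝ}

lemma mono (h : Arc γ D d a b x) {a' b' : ℝ} (ha : a ≤ a') (hab : a' ≤ b') (hb : b' ≤ b) :
    Arc γ D d a' b' x := by
  have hs : uIcc a' b' ⊆ uIcc a b := by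
    rw [uIcc_of_le hab, uIcc_of_le (ha.trans (hab.trans hb))]; exact Icc_subset_Icc ha hb
  refine ⟨h.fst.mono hs, h.snd.mono hs, ?_⟩
  filter_upwards [h.ode] with t ht hm
  exact ht ⟨ha.trans_lt hm.1, hm.2.trans_le hb⟩

protected lemma neg (h : Arc γ D d a b x) : Arc γ D (-d) a b (-x) := by
  refine ⟨h.fst.fun_neg, h.snd.fun_neg, ?_⟩
  filter_upwards [h.ode] with t ht hm
  obtain ⟨h1, ⟨u, hu, h2⟩, h3⟩ := ht hm
  refine ⟨h1.fun_neg, ⟨-u, neg_mem_control hu, ?_⟩, by simpa using h3⟩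
  convert! h2.fun_neg using 1
  simp; ring

lemma continuousOn_fst (h : Arc γ D d a b x) (hab : a ≤ b) :
    ContinuousOn (fun t => (x t).1) (Icc a b) := uIcc_of_le hab ▸ h.fst.continuousOn

lemma continuousOn_snd (h : Arc γ D d a b x) (hab : a ≤ b) :
    ContinuousOn (fun t => (x t).2) (Icc a b) := uIcc_of_le hab ▸ h.snd.continuousOn

lemma ae_fst (h : Arc γ D d a b x) :
    ∀ᵐ t, t ∈ Ioo a b → HasDerivAt (fun s => (x s).1) (x t).2 t := by
  filter_upwards [h.ode] with t ht hm using (ht hm).1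

lemma ae_right (h : Arc γ D d a b x) :
    ∀ᵐ t, t ∈ Ioo a b → 0 < (x t).1 → HasDerivAt (fun s => (x s).1) (x t).2 t ∧
      HasDerivAt (fun s => (x s).2) (-γ + brake (x t) + d t) t ∧ -D ≤ d t ∧ d t ≤ D := by
  filter_upwards [h.ode] with t ht hm hpos
  obtain ⟨h1, ⟨u, hu, h2⟩, h3⟩ := ht hm
  rw [mem_control_iff_of_pos hpos] at hu
  exact ⟨h1, hu ▸ h2, (abs_le.1 h3).1, (abs_le.1 h3).2⟩

lemma fst_sub_le (h : Arc γ D d a b x) (hab : a ≤ b) {c : ℝ} (hc : ∀ t ∈ Ioo a b, (x t).2 ≤ c) :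
    (x b).1 - (x a).1 ≤ c * (b - a) :=
  sub_le_of_ae_hasDerivAt_le hab h.fst (by
    filter_upwards [h.ae_fst] with t ht hm using ⟨_, hc t hm, ht hm⟩)

lemma le_fst_sub (h : Arc γ D d a b x) (hab : a ≤ b) {c : ℝ} (hc : ∀ t ∈ Ioo a b, c ≤ (x t).2) :
    c * (b - a) ≤ (x b).1 - (x a).1 :=
  le_sub_of_ae_le_hasDerivAt hab h.fst (by
    filter_upwards [h.ae_fst] with t ht hm using ⟨_, hc t hm, ht hm⟩)

/-! ### The flow in the right half-plane -/

lemma snd_sub_le (h : Arc γ D d a b x) (hab : a ≤ b) (hpos : ∀ t ∈ Ioo a b, 0 < (x t).1) {c : ℝ}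
    (hc : ∀ t ∈ Ioo a b, brake (x t) ≤ c) : (x b).2 - (x a).2 ≤ (-γ + c + D) * (b - a) :=
  sub_le_of_ae_hasDerivAt_le hab h.snd (by
    filter_upwards [h.ae_right] with t ht hm
    obtain ⟨-, h2, -, h4⟩ := ht hm (hpos t hm)
    exact ⟨_, by linarith [hc t hm], h2⟩)

lemma le_snd_sub (h : Arc γ D d a b x) (hab : a ≤ b) (hpos : ∀ t ∈ Ioo a b, 0 < (x t).1) :
    (-γ - D) * (b - a) ≤ (x b).2 - (x a).2 :=
  le_sub_of_ae_le_hasDerivAt hab h.snd (by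
    filter_upwards [h.ae_right] with t ht hm
    obtain ⟨-, h2, h3, -⟩ := ht hm (hpos t hm)
    exact ⟨_, by linarith [brake_nonneg (hpos t hm).le], h2⟩)

lemma fst_nonneg (h : Arc γ D d a b x) (hab : a < b) (hpos : ∀ t ∈ Ioo a b, 0 < (x t).1) :
    ∀ t ∈ Icc a b, 0 ≤ (x t).1 := by
  intro t ht
  rw [← closure_Ioo hab.ne] at ht
  refine le_on_closure (f := fun _ => (0 : ℝ)) (fun t ht => (hpos t ht).le) continuousOn_const ?_ ht
  rw [closure_Ioo hab.ne]
  exact h.continuousOn_fst hab.le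

/-- The parabolas `x₂² = K x₁` with `K ≥ 2(γ + D)` act as barriers in the fourth quadrant: the
ratio `w = x₂² / x₁` satisfies `w' = |x₂| / x₁ * (2 (γ - d) - w)`. -/
lemma min_sq_le (h : Arc γ D d a b x) (hab : a ≤ b) (hpos : ∀ t ∈ Ioo a b, 0 < (x t).1) {K : ℝ}
    (hK0 : 0 ≤ K) (hK : 2 * (γ + D) ≤ K) (ha : (min (x a).2 0) ^ 2 ≤ K * (x a).1) :
    ∀ t ∈ Icc a b, (min (x t).2 0) ^ 2 ≤ K * (x t).1 := by
  rcases hab.eq_or_lt with rfl | hlt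
  · intro t ht; rw [Icc_self, mem_singleton_iff] at ht; rwa [ht]
  have hc1 := h.continuousOn_fst hab
  have hc2 := h.continuousOn_snd hab
  have hnn := h.fst_nonneg hlt hpos
  have := le_of_barrier (f := fun t => (min (x t).2 0) ^ 2 - K * (x t).1) (c := 0) (a := a) (b := b)
    (by fun_prop) (by simpa using ha) (fun s t has hst htb hgt => ?_)
  · intro t ht; simpa using this t ht
  have hst' := h.mono has hst htb
  -- above the barrier the state is in the fourth quadrant
  have hneg : ∀ τ ∈ Icc s t, (x τ).2 < 0 := by
    intro τ hτ
    by_contra! hle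
    have h1 := hgt τ hτ
    have h2 := hnn τ ⟨has.trans hτ.1, hτ.2.trans htb⟩
    simp only [min_eq_right hle] at h1
    nlinarith
  have key := sub_le_of_ae_hasDerivAt_le (c := 0) hst
    ((hst'.snd.fun_mul hst'.snd).fun_sub (hst'.fst.const_mul K)) (by
      filter_upwards [hst'.ae_right] with τ hτ hm
      have hp := hpos τ ⟨has.trans_lt hm.1, hm.2.trans_le htb⟩
      obtain ⟨h1, h2, h3, h4⟩ := hτ hm hp
      refine ⟨_, ?_, (h2.fun_mul h2).fun_sub (h1.const_mul K)⟩
      have hn := hneg τ (Ioo_subset_Icc_self hm)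
      have hg := hgt τ (Ioo_subset_Icc_self hm)
      have hbr : K ≤ brake (x τ) := by
        unfold brake; rw [le_div_iff₀ hp]; linarith
      have : 0 ≤ -(x τ).2 * (2 * (-γ + brake (x τ) + d τ) - K) :=
        mul_nonneg (by linarith) (by linarith)
      linarith)
  simp only [min_eq_left (hneg s ⟨le_rfl, hst⟩).le, min_eq_left (hneg t ⟨hst, le_rfl⟩).le]
  linarith

/-- Trajectories enter `{x₁ > 0}` immediately from every point of `RightHalf`. -/
lemma exists_pos_of_mem_rightHalf (h : Arc γ D d a b x) (hab : a < b) (ha : x a ∈ RightHalf) :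
    ∃ c ∈ Ioc a b, ∀ t ∈ Ioo a c, 0 < (x t).1 := by
  have hmem : a ∈ Icc a b := ⟨le_rfl, hab.le⟩
  rcases ha with h1 | ⟨h1, h2⟩
  · have := (h.continuousOn_fst hab.le a hmem).eventually_const_lt h1
    rw [nhdsWithin_Icc_eq_nhdsGE hab, (nhdsGE_basis a).eventually_iff] at this
    obtain ⟨c, hc, H⟩ := this
    exact ⟨min c b, ⟨lt_min hc hab, min_le_right _ _⟩, fun t ht =>
      H ⟨ht.1.le, ht.2.trans_le (min_le_left _ _)⟩⟩
  · obtain ⟨m, hm0, hm⟩ := exists_between h2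
    have := (h.continuousOn_snd hab.le a hmem).eventually_const_lt hm
    rw [nhdsWithin_Icc_eq_nhdsGE hab, (nhdsGE_basis a).eventually_iff] at this
    obtain ⟨c, hc, H⟩ := this
    refine ⟨min c b, ⟨lt_min hc hab, min_le_right _ _⟩, fun t ht => ?_⟩
    have htc := ht.2.trans_le (min_le_left _ _)
    have := (h.mono le_rfl ht.1.le (ht.2.le.trans (min_le_right _ _))).le_fst_sub (c := m) ht.1.le
      (fun τ hτ => (H ⟨hτ.1.le, hτ.2.trans htc⟩).le)
    have : 0 < m * (t - a) := mul_pos hm0 (by linarith [ht.1])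
    linarith

/-- A trajectory can leave the right half-plane only through the origin: by the barriers
`x₂² = K x₁` it cannot reach the half-axis `x₁ = 0 > x₂`. -/
lemma pos_of_mem_rightHalf (h : Arc γ D d a b x) (hD : 0 ≤ D) (hγ : D < γ) (ha : x a ∈ RightHalf)
    (hne : ∀ t ∈ Icc a b, x t ≠ 0) : ∀ t ∈ Ioc a b, 0 < (x t).1 := by
  intro t₁ ht₁
  by_contra! hle
  have h' := h.mono le_rfl ht₁.1.le ht₁.2
  obtain ⟨c, hc, hcpos⟩ := h'.exists_pos_of_mem_rightHalf ht₁.1 ha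
  obtain ⟨s, ⟨hs1, hs2⟩, hs0, hspos⟩ :=
    exists_first_zero (h'.continuousOn_fst ht₁.1.le) hc.1 hcpos ht₁.1 hle
  have hs := h.mono le_rfl hs1.le (hs2.trans ht₁.2)
  have hcont := (hs.continuousOn_snd hs1.le) s ⟨hs1.le, le_rfl⟩
  have hx2 : (x s).2 ≠ 0 := fun h0 => hne s ⟨hs1.le, hs2.trans ht₁.2⟩ (Prod.ext hs0 h0)
  rcases lt_or_gt_of_ne hx2 with hneg | hgt
  · have := hcont.eventually_lt_const hneg
    rw [nhdsWithin_Icc_eq_nhdsLE hs1, (nhdsLE_basis s).eventually_iff] at this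
    obtain ⟨c, hc, H⟩ := this
    obtain ⟨r, hr1, hr2⟩ := exists_between (max_lt hc hs1)
    have har := (le_max_right _ _).trans_lt hr1
    have hrs := hs.mono har.le hr2.le le_rfl
    have hrpos := hspos r ⟨har, hr2⟩
    have := hrs.min_sq_le hr2.le (fun τ hτ => hspos τ ⟨har.trans hτ.1, hτ.2⟩)
      (K := max (2 * (γ + D)) (brake (x r))) (le_max_of_le_left (by linarith)) (le_max_left _ _)
      ((div_le_iff₀ hrpos).1 (le_max_right (2 * (γ + D)) (brake (x r)))) s ⟨hr2.le, le_rfl⟩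
    rw [hs0, min_eq_left hneg.le] at this
    nlinarith
  · have := hcont.eventually_const_lt hgt
    rw [nhdsWithin_Icc_eq_nhdsLE hs1, (nhdsLE_basis s).eventually_iff] at this
    obtain ⟨c, hc, H⟩ := this
    obtain ⟨r, hr1, hr2⟩ := exists_between (max_lt hc hs1)
    have har := (le_max_right _ _).trans_lt hr1
    have hcr := (le_max_left _ _).trans_lt hr1
    have := (hs.mono har.le hr2.le le_rfl).le_fst_sub (c := 0) hr2.le
      (fun τ hτ => (H ⟨hcr.trans hτ.1, hτ.2.le⟩).le)
    linarith [hspos r ⟨har, hr2⟩]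

/-- In the right half-plane, `x₂` cannot become positive again. -/
lemma snd_nonpos (h : Arc γ D d a b x) (hγ : D < γ) (hab : a ≤ b)
    (hpos : ∀ t ∈ Ioo a b, 0 < (x t).1) (ha : (x a).2 ≤ 0) : ∀ t ∈ Icc a b, (x t).2 ≤ 0 := by
  refine le_of_barrier (h.continuousOn_snd hab) ha (fun s t has hst htb hgt => ?_)
  have := (h.mono has hst htb).snd_sub_le hst (c := 0)
    (fun τ hτ => hpos τ ⟨has.trans_lt hτ.1, hτ.2.trans_le htb⟩)
    (fun τ hτ => (brake_of_nonneg (hgt τ (Ioo_subset_Icc_self hτ)).le).le)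
  nlinarith

/-- In the right half-plane, a trajectory with `x₂ ≤ 0` has `x₂ < 0` immediately afterwards: where
`x₂ = 0 < x₁` the damping is small, so that `x₂` decreases. -/
lemma snd_neg (h : Arc γ D d a b x) (hγ : D < γ) (hpos : ∀ t ∈ Icc a b, 0 < (x t).1)
    (ha : (x a).2 ≤ 0) : ∀ t ∈ Ioc a b, (x t).2 < 0 := by
  intro t ht
  have hab := ht.1.le.trans ht.2
  have hle := h.snd_nonpos hγ hab (fun τ hτ => hpos τ (Ioo_subset_Icc_self hτ)) ha
  refine lt_of_le_of_ne (hle t ⟨ht.1.le, ht.2⟩) (fun h0 => ?_)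
  have hat := h.mono le_rfl ht.1.le ht.2
  have htm : t ∈ Icc a t := ⟨ht.1.le, le_rfl⟩
  have hcb : ContinuousWithinAt (fun τ => brake (x τ)) (Icc a t) t := by
    have h1 := hat.continuousOn_fst ht.1.le t htm
    have h2 := hat.continuousOn_snd ht.1.le t htm
    exact ((h2.min continuousWithinAt_const).pow 2).div h1 (hpos t ⟨ht.1.le, ht.2⟩).ne'
  have hb0 : brake (x t) < (γ - D) / 2 := by rw [brake_of_nonneg h0.ge]; linarith
  have := hcb.eventually_lt_const hb0
  rw [nhdsWithin_Icc_eq_nhdsLE ht.1, (nhdsLE_basis t).eventually_iff] at this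
  obtain ⟨c, hc, H⟩ := this
  obtain ⟨r, hr1, hr2⟩ := exists_between (max_lt hc ht.1)
  have har := (le_max_right _ _).trans_lt hr1
  have hcr := (le_max_left _ _).trans_lt hr1
  have := (hat.mono har.le hr2.le le_rfl).snd_sub_le (c := (γ - D) / 2) hr2.le
    (fun τ hτ => hpos τ ⟨(har.trans hτ.1).le, hτ.2.le.trans ht.2⟩)
    (fun τ hτ => (H ⟨hcr.trans hτ.1, hτ.2.le⟩).le)
  have := hle r ⟨har.le, hr2.le.trans ht.2⟩
  nlinarith

/-- The origin is never left. -/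
lemma eq_zero (h : Arc γ D d a b x) (hD : 0 ≤ D) (hγ : D < γ) (ha : x a = 0) :
    ∀ t ∈ Icc a b, x t = 0 := by
  -- a trajectory in `{x₁ > 0}` cannot emanate from the origin
  have key : ∀ {d : ℝ → ℝ} {x : ℝ → ℝ × ℝ} {a b : ℝ}, a < b → Arc γ D d a b x → x a = 0 →
      ¬ ∀ t ∈ Ioc a b, 0 < (x t).1 := by
    intro d x a b hab h ha hpos
    have h2 := h.snd_nonpos hγ hab.le (fun τ hτ => hpos τ (Ioo_subset_Ioc_self hτ)) (by simp [ha])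
    have := h.fst_sub_le hab.le (c := 0) (fun τ hτ => h2 τ (Ioo_subset_Icc_self hτ))
    have := hpos b ⟨hab, le_rfl⟩
    simp only [ha, Prod.fst_zero] at *
    linarith
  intro t ht
  by_contra hne
  have hat := h.mono le_rfl ht.1 ht.2
  -- `s` is the last time at which the trajectory is at the origin
  have hK : IsCompact (Icc a t ∩ x ⁻¹' {0}) := by
    refine isCompact_Icc.of_isClosed_subset (ContinuousOn.preimage_isClosed_of_isClosed ?_
      isClosed_Icc isClosed_singleton) inter_subset_left
    exact (hat.continuousOn_fst ht.1).prodMk (hat.continuousOn_snd ht.1)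
  obtain ⟨s, ⟨⟨hs1, hs2⟩, hs0⟩, hs4⟩ := hK.exists_isGreatest ⟨a, ⟨le_rfl, ht.1⟩, ha⟩
  have hs0 : x s = 0 := hs0
  have hst : s < t := lt_of_le_of_ne hs2 (by rintro rfl; exact hne hs0)
  have hgt : ∀ τ ∈ Ioc s t, x τ ≠ 0 := fun τ hτ h0 =>
    absurd (hs4 ⟨⟨hs1.trans hτ.1.le, hτ.2⟩, h0⟩) (not_le.2 hτ.1)
  have hS := hat.mono hs1 hst.le le_rfl
  by_cases hR : ∀ τ ∈ Ioc s t, 0 < (x τ).1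
  · exact key hst hS hs0 hR
  by_cases hL : ∀ τ ∈ Ioc s t, 0 < ((-x) τ).1
  · exact key hst hS.neg (by simp [hs0]) hL
  -- the trajectory stays in the half-plane in which it is at any time after `s`
  push Not at hR hL
  obtain ⟨p, hp, hp1⟩ := hR
  obtain ⟨q, hq, hq1⟩ := hL
  have hnR : ∀ τ ∈ Ioo s p, x τ ∉ RightHalf := fun τ hτ hm =>
    absurd ((hS.mono hτ.1.le (hτ.2.le.trans hp.2) le_rfl).pos_of_mem_rightHalf hD hγ hm
      (fun σ hσ => hgt σ ⟨hτ.1.trans_le hσ.1, hσ.2⟩) p ⟨hτ.2, hp.2⟩) (not_lt.2 hp1)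
  have hnL : ∀ τ ∈ Ioo s q, -x τ ∉ RightHalf := fun τ hτ hm =>
    absurd ((hS.neg.mono hτ.1.le (hτ.2.le.trans hq.2) le_rfl).pos_of_mem_rightHalf hD hγ hm
      (fun σ hσ => neg_ne_zero.2 (hgt σ ⟨hτ.1.trans_le hσ.1, hσ.2⟩)) q ⟨hτ.2, hq.2⟩) (not_lt.2 hq1)
  obtain ⟨τ, hτ1, hτ2⟩ := exists_between (lt_min hp.1 hq.1)
  have hτp := hτ2.trans_le (min_le_left _ _)
  rcases eq_zero_or_mem_rightHalf (x τ) with h0 | h0 | h0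
  · exact hgt τ ⟨hτ1, hτp.le.trans hp.2⟩ h0
  · exact hnR τ ⟨hτ1, hτp⟩ h0
  · exact hnL τ ⟨hτ1, hτ2.trans_le (min_le_right _ _)⟩ h0

end Arc

namespace Arc

variable {γ D a b : ℝ} {d : ℝ → ℝ} {x : ℝ → ℝ × ℝ}

/-! ### Duration of the descent and of the ascent -/

/-- A trajectory in the fourth quadrant reaches the origin within a time determined by `x₁`:
put `m = (γ - D) / 2`. As long as `x₂² < m x₁`, the speed `|x₂|` grows at least at the rate `m`.
The reverse inequality persists once it holds, and then `√x₁` decreases at least at the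
rate `√m / 2`. -/
lemma descent_time_le (h : Arc γ D d a b x) (hγ : D < γ) (hab : a ≤ b)
    (hpos : ∀ t ∈ Icc a b, 0 < (x t).1) (hneg : ∀ t ∈ Icc a b, (x t).2 ≤ 0) {r : ℝ}
    (hr : (x a).1 ≤ r) : b - a ≤ 3 * √(r / ((γ - D) / 2)) := by
  set m := (γ - D) / 2 with hm
  have hm0 : 0 < m := by linarith
  set ℓ := √(r / m) with hℓ
  have hr0 : 0 < r := (hpos a ⟨le_rfl, hab⟩).trans_le hr
  have hℓ0 : 0 < ℓ := Real.sqrt_pos.2 (by positivity)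
  have hℓsq : m * ℓ ^ 2 = r := by
    rw [hℓ, Real.sq_sqrt (by positivity)]; field_simp
  by_contra! hlt
  have hle : ∀ t ∈ Icc a b, (x t).1 ≤ r := by
    intro t ht
    have := (h.mono le_rfl ht.1 ht.2).fst_sub_le (c := 0) ht.1
      (fun τ hτ => hneg τ ⟨hτ.1.le, hτ.2.le.trans ht.2⟩)
    linarith
  obtain ⟨s, hs, hsm⟩ : ∃ s ∈ Icc a (a + ℓ), m * (x s).1 ≤ (x s).2 ^ 2 := by
    by_contra! hall
    have hbr : ∀ τ ∈ Ioo a (a + ℓ), brake (x τ) ≤ m := by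
      intro τ hτ
      have hτb : τ ∈ Icc a b := ⟨hτ.1.le, by linarith [hτ.2]⟩
      rw [brake_of_nonpos (hneg τ hτb), div_le_iff₀ (hpos τ hτb)]
      exact (hall τ (Ioo_subset_Icc_self hτ)).le
    have h1 := (h.mono le_rfl (by linarith : a ≤ a + ℓ) (by linarith)).snd_sub_le (by linarith)
      (fun τ hτ => hpos τ ⟨hτ.1.le, by linarith [hτ.2]⟩) hbr
    have h2 := hall (a + ℓ) ⟨by linarith, le_rfl⟩
    have h3 := hle (a + ℓ) ⟨by linarith, by linarith⟩
    have h4 := hneg a ⟨le_rfl, hab⟩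
    have h5 : m * ℓ ≤ -(x (a + ℓ)).2 := by nlinarith
    have h6 : (m * ℓ) ^ 2 ≤ (-(x (a + ℓ)).2) ^ 2 := pow_le_pow_left₀ (by positivity) h5 2
    nlinarith
  have hsb : s ≤ b := by linarith [hs.2]
  have hsA := h.mono hs.1 hsb le_rfl
  have hkeep : ∀ t ∈ Icc s b, m * (x t).1 - (x t).2 * (x t).2 ≤ 0 := by
    refine le_of_ae_barrier hsb ((hsA.fst.const_mul m).fun_sub (hsA.snd.fun_mul hsA.snd))
      (by nlinarith) ?_
    filter_upwards [hsA.ae_right] with t ht hmem hgt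
    have htb : t ∈ Icc a b := ⟨hs.1.trans hmem.1.le, hmem.2.le⟩
    obtain ⟨h1, h2, h3, h4⟩ := ht hmem (hpos t htb)
    refine ⟨_, ?_, (h1.const_mul m).fun_sub (h2.fun_mul h2)⟩
    have hbr : brake (x t) ≤ m := by
      rw [brake_of_nonpos (hneg t htb), div_le_iff₀ (hpos t htb)]; nlinarith
    have : 0 ≤ -(x t).2 * (m - 2 * (-γ + brake (x t) + d t)) :=
      mul_nonneg (by linarith [hneg t htb]) (by linarith)
    linarith
  -- `x₁` stays below `(A - √m / 2 * (t - s)) ^ 2`, which vanishes at `t = e`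
  set A := √(x s).1 with hA
  have hxs := hpos s ⟨hs.1, hsb⟩
  have hA0 : 0 < A := Real.sqrt_pos.2 hxs
  have hAℓ : A ≤ √m * ℓ := by
    rw [hA, hℓ, ← Real.sqrt_mul hm0.le, mul_div_cancel₀ _ hm0.ne']
    exact Real.sqrt_le_sqrt (hle s ⟨hs.1, hsb⟩)
  have hq0 : 0 < √m := Real.sqrt_pos.2 hm0
  have hqq : √m * √m = m := Real.mul_self_sqrt hm0.le
  set e := s + 2 * A / √m with he
  have hse : s ≤ e := by rw [he]; have : 0 ≤ 2 * A / √m := by positivity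
                         linarith
  have heb : e ≤ b := by
    have : 2 * A / √m ≤ 2 * ℓ := by rw [div_le_iff₀ hq0]; linarith
    linarith [hs.2]
  have hθ : ∀ t ∈ Icc s e, (x t).1 - (A - √m / 2 * (t - s)) ^ 2 ≤ 0 := by
    refine le_of_ae_barrier hse ((hsA.fst.mono ?_).fun_sub
      (ContDiff.contDiffOn (by fun_prop)).absolutelyContinuousOnInterval) ?_ ?_
    · rw [uIcc_of_le hse, uIcc_of_le hsb]; exact Icc_subset_Icc_right heb
    · simp [hA, Real.sq_sqrt hxs.le]
    filter_upwards [hsA.ae_fst] with t ht hmem hgt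
    have hd : HasDerivAt (fun t => (A - √m / 2 * (t - s)) ^ 2)
        (2 * (A - √m / 2 * (t - s)) * (-(√m / 2))) t := by
      have := ((((hasDerivAt_id t).sub_const s).const_mul (√m / 2)).const_sub A).fun_pow 2
      convert! this using 1
      simp
    refine ⟨_, ?_, (ht ⟨hmem.1, hmem.2.trans_le heb⟩).fun_sub hd⟩
    have hθ0 : 0 ≤ A - √m / 2 * (t - s) := by
      have : t - s ≤ 2 * A / √m := by linarith [hmem.2]
      rw [le_div_iff₀ hq0] at this
      linarith
    have hk := hkeep t ⟨hmem.1.le, hmem.2.le.trans heb⟩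
    have hn := hneg t ⟨hs.1.trans hmem.1.le, hmem.2.le.trans heb⟩
    have : √m * (A - √m / 2 * (t - s)) ≤ -(x t).2 := by
      refine (pow_le_pow_iff_left₀ (mul_nonneg hq0.le hθ0) (by linarith) two_ne_zero).1 ?_
      rw [mul_pow, pow_two √m, hqq]
      nlinarith
    linarith
  have h1 := hθ e ⟨hse, le_rfl⟩
  have h2 : A - √m / 2 * (e - s) = 0 := by rw [he]; field_simp; ring
  rw [h2] at h1
  linarith [hpos e ⟨hs.1.trans hse, heb⟩]

lemma pos_of_snd_nonneg (h : Arc γ D d a b x) (ha : x a ∈ RightHalf)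
    (h2 : ∀ t ∈ Icc a b, 0 ≤ (x t).2) : ∀ t ∈ Ioc a b, 0 < (x t).1 := by
  intro t ht
  have h' := h.mono le_rfl ht.1.le ht.2
  obtain ⟨c, hc, hcpos⟩ := h'.exists_pos_of_mem_rightHalf ht.1 ha
  obtain ⟨r, hr1, hr2⟩ := exists_between (lt_min ht.1 hc.1)
  have hrt := hr2.trans_le (min_le_left _ _)
  have := (h'.mono hr1.le hrt.le le_rfl).le_fst_sub (c := 0) hrt.le
    (fun τ hτ => h2 τ ⟨(hr1.trans hτ.1).le, hτ.2.le.trans ht.2⟩)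
  linarith [hcpos r ⟨hr1, hr2.trans_le (min_le_right _ _)⟩]

/-- From the first quadrant, `x₂` reaches zero at a time between `x₂(a) / (γ + D)` and
`x₂(a) / (γ - D)`. -/
lemma exists_turn (h : Arc γ D d a b x) (hD : 0 ≤ D) (hγ : D < γ) (ha : x a ∈ RightHalf)
    (h2 : 0 ≤ (x a).2) (hb : (x a).2 / (γ - D) < b - a) :
    ∃ s ∈ Ico a b, (∀ t ∈ Icc a s, 0 ≤ (x t).1 ∧ 0 ≤ (x t).2) ∧ (x s).2 = 0 ∧ 0 < (x s).1 ∧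
      (x s).1 ≤ (x a).1 + (x a).2 * (s - a) ∧
      (x a).2 / (γ + D) ≤ s - a ∧ s - a ≤ (x a).2 / (γ - D) := by
  have hm : 0 < γ - D := by linarith
  have hp : 0 < γ + D := by linarith
  have hab : a < b := by have : 0 ≤ (x a).2 / (γ - D) := by positivity
                         linarith
  rcases h2.eq_or_lt with h0 | h0
  · have h1 : 0 < (x a).1 := by
      rcases ha with h1 | ⟨-, h1⟩
      · exact h1
      · exact absurd h1 (by linarith)
    refine ⟨a, ⟨le_rfl, hab⟩, fun t ht => ?_, h0.symm, h1, ?_⟩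
    · rw [Icc_self, mem_singleton_iff] at ht
      rw [ht]; exact ⟨h1.le, h2⟩
    · simp [← h0]
  obtain ⟨t₁, ht₁, hle⟩ : ∃ t ∈ Ioc a b, (x t).2 ≤ 0 := by
    by_contra! hall
    have hnn : ∀ t ∈ Icc a b, 0 ≤ (x t).2 := fun t ht => by
      rcases ht.1.eq_or_lt with rfl | hlt
      · exact h2
      · exact (hall t ⟨hlt, ht.2⟩).le
    have h3 := h.snd_sub_le hab.le (c := 0)
      (fun τ hτ => h.pos_of_snd_nonneg ha hnn τ (Ioo_subset_Ioc_self hτ))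
      (fun τ hτ => (brake_of_nonneg (hnn τ (Ioo_subset_Icc_self hτ))).le)
    have h4 := hall b ⟨hab, le_rfl⟩
    rw [div_lt_iff₀ hm] at hb
    nlinarith
  have h' := h.mono le_rfl ht₁.1.le ht₁.2
  have hcont := h'.continuousOn_snd ht₁.1.le
  have := (hcont a ⟨le_rfl, ht₁.1.le⟩).eventually_const_lt h0
  rw [nhdsWithin_Icc_eq_nhdsGE ht₁.1, (nhdsGE_basis a).eventually_iff] at this
  obtain ⟨c, hc, H⟩ := this
  obtain ⟨s, hs, hs0, hspos⟩ :=
    exists_first_zero hcont hc (fun t ht => H ⟨ht.1.le, ht.2⟩) ht₁.1 hle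
  have hnn : ∀ t ∈ Icc a s, 0 ≤ (x t).2 := fun t ht => by
    rcases ht.1.eq_or_lt with rfl | hlt
    · exact h2
    rcases ht.2.eq_or_lt with rfl | hlt'
    · exact hs0.ge
    · exact (hspos t ⟨hlt, hlt'⟩).le
  have hS := h.mono le_rfl hs.1.le (hs.2.trans ht₁.2)
  have hpos := hS.pos_of_snd_nonneg ha hnn
  have hpos' : ∀ t ∈ Ioo a s, 0 < (x t).1 := fun t ht => hpos t (Ioo_subset_Ioc_self ht)
  have hbr : ∀ t ∈ Ioo a s, brake (x t) ≤ 0 := fun t ht =>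
    (brake_of_nonneg (hnn t (Ioo_subset_Icc_self ht))).le
  have hup := hS.snd_sub_le hs.1.le hpos' hbr
  have hlo := hS.le_snd_sub hs.1.le hpos'
  rw [hs0] at hup hlo
  have hdur : s - a ≤ (x a).2 / (γ - D) := by rw [le_div_iff₀ hm]; linarith
  have hx2 : ∀ t ∈ Ioo a s, (x t).2 ≤ (x a).2 := fun t ht => by
    have := (hS.mono le_rfl ht.1.le ht.2.le).snd_sub_le ht.1.le (c := 0)
      (fun τ hτ => hpos' τ ⟨hτ.1, hτ.2.trans ht.2⟩) (fun τ hτ => hbr τ ⟨hτ.1, hτ.2.trans ht.2⟩)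
    nlinarith [ht.1]
  refine ⟨s, ⟨hs.1.le, by linarith⟩, fun t ht => ⟨?_, hnn t ht⟩, hs0, hpos s ⟨hs.1, le_rfl⟩, ?_, ?_,
    hdur⟩
  · exact hS.fst_nonneg hs.1 hpos' t ht
  · linarith [hS.fst_sub_le hs.1.le hx2]
  · rw [div_le_iff₀ hp]; linarith

end Arc

/-! ### Uniqueness -/

lemma abs_brake_sub_le {p q : ℝ × ℝ} {c M : ℝ} (hc : 0 < c) (hp : c ≤ p.1) (hq : c ≤ q.1)
    (hpM : |p.2| ≤ M) (hqM : |q.2| ≤ M) :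
    |brake p - brake q| ≤ (2 * M / c + M ^ 2 / c ^ 2) * (|p.1 - q.1| + |p.2 - q.2|) := by
  have hp0 := hc.trans_le hp
  have hq0 := hc.trans_le hq
  have hM : 0 ≤ M := (abs_nonneg _).trans hpM
  have hmin : ∀ z : ℝ, |z| ≤ M → |min z 0| ≤ M := fun z hz =>
    (abs_min_le_max_abs_abs).trans (by simp [hz])
  set u := min p.2 0 with hu
  set v := min q.2 0 with hv
  have huM : |u| ≤ M := hmin _ hpM
  have hvM : |v| ≤ M := hmin _ hqM
  have huv : |u - v| ≤ |p.2 - q.2| := by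
    simpa using abs_min_sub_min_le_max p.2 0 q.2 0
  have h1 : brake p - brake q = (u + v) / p.1 * (u - v) + v ^ 2 / (p.1 * q.1) * (q.1 - p.1) := by
    simp only [brake, ← hu, ← hv]; field_simp; ring
  have h2 : |(u + v) / p.1| ≤ 2 * M / c := by
    rw [abs_div, abs_of_pos hp0]
    have : |u + v| ≤ 2 * M := (abs_add_le u v).trans (by linarith)
    gcongr
  have h3 : |v ^ 2 / (p.1 * q.1)| ≤ M ^ 2 / c ^ 2 := by
    rw [abs_div, abs_pow, abs_of_pos (mul_pos hp0 hq0), pow_two c]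
    gcongr
  rw [h1]
  refine (abs_add_le _ _).trans ?_
  rw [abs_mul, abs_mul, abs_sub_comm q.1]
  have h4 : |(u + v) / p.1| * |u - v| ≤ 2 * M / c * |p.2 - q.2| := by gcongr
  have h5 : |v ^ 2 / (p.1 * q.1)| * |p.1 - q.1| ≤ M ^ 2 / c ^ 2 * |p.1 - q.1| := by gcongr
  have h6 : 0 ≤ 2 * M / c * |p.1 - q.1| := by positivity
  have h7 : 0 ≤ M ^ 2 / c ^ 2 * |p.2 - q.2| := by positivity
  linarith

namespace Arc

variable {γ D a b : ℝ} {d : ℝ → ℝ} {x y : ℝ → ℝ × ℝ}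

/-- Grönwall's argument in the right half-plane: the disturbance cancels in the difference of two
solutions. -/
lemma eq_of_brake_lipschitz (hx : Arc γ D d a b x) (hy : Arc γ D d a b y) (hab : a ≤ b)
    (h0 : x a = y a) {L : ℝ} (hL : 0 ≤ L)
    (h : ∀ t ∈ Ioo a b, 0 < (x t).1 ∧ 0 < (y t).1 ∧
      |brake (x t) - brake (y t)| ≤ L * (|(x t).1 - (y t).1| + |(x t).2 - (y t).2|)) :
    x b = y b := by
  have h1 := hx.fst.fun_sub hy.fst
  have h2 := hx.snd.fun_sub hy.snd
  have hexp : AbsolutelyContinuousOnInterval (fun t => Real.exp (-(1 + 3 * L) * t)) a b :=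
    (ContDiff.contDiffOn (by fun_prop)).absolutelyContinuousOnInterval
  have key := sub_le_of_ae_hasDerivAt_le (c := 0) hab
    (((h1.fun_mul h1).fun_add (h2.fun_mul h2)).fun_mul hexp) (by
      filter_upwards [hx.ae_right, hy.ae_right] with t htx hty hm
      obtain ⟨p1, p2, p3⟩ := h t hm
      obtain ⟨x1, x2, -⟩ := htx hm p1
      obtain ⟨y1, y2, -⟩ := hty hm p2
      have e1 := x1.fun_sub y1
      have e2 := x2.fun_sub y2
      have e3 : HasDerivAt (fun t => Real.exp (-(1 + 3 * L) * t))
          (Real.exp (-(1 + 3 * L) * t) * (-(1 + 3 * L))) t := by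
        simpa using ((hasDerivAt_id t).const_mul (-(1 + 3 * L))).exp
      refine ⟨_, ?_, ((e1.fun_mul e1).fun_add (e2.fun_mul e2)).fun_mul e3⟩
      set U := (x t).1 - (y t).1
      set V := (x t).2 - (y t).2
      set Δ := brake (x t) - brake (y t) with hΔ
      have hΔe : -γ + brake (x t) + d t - (-γ + brake (y t) + d t) = Δ := by rw [hΔ]; ring
      rw [hΔe]
      have hE := Real.exp_pos (-(1 + 3 * L) * t)
      have hVΔ : V * Δ ≤ L * (|U| * |V| + |V| * |V|) := by
        calc V * Δ ≤ |V| * |Δ| := by rw [← abs_mul]; exact le_abs_self _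
          _ ≤ |V| * (L * (|U| + |V|)) := by gcongr
          _ = _ := by ring
      have hUV : U * V ≤ |U| * |V| := by rw [← abs_mul]; exact le_abs_self _
      have hU2 : |U| * |U| = U * U := abs_mul_abs_self U
      have hV2 : |V| * |V| = V * V := abs_mul_abs_self V
      have hsq : 2 * (|U| * |V|) ≤ U * U + V * V := by nlinarith [sq_nonneg (|U| - |V|)]
      have hLs : L * (2 * (|U| * |V|)) ≤ L * (U * U + V * V) := by gcongr
      have hLU : 0 ≤ L * (U * U) := mul_nonneg hL (mul_self_nonneg U)
      rw [hV2] at hVΔ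
      have : 2 * (U * V) + 2 * (V * Δ) - (1 + 3 * L) * (U * U + V * V) ≤ 0 := by linarith
      nlinarith)
  have hE := Real.exp_pos (-(1 + 3 * L) * b)
  simp only [h0, sub_self, mul_zero, add_zero, zero_mul, sub_zero] at key
  have hsum : ((x b).1 - (y b).1) * ((x b).1 - (y b).1) +
      ((x b).2 - (y b).2) * ((x b).2 - (y b).2) ≤ 0 := by
    by_contra! hgt
    linarith [mul_pos hgt hE]
  refine Prod.ext ?_ ?_ <;> nlinarith

lemma exists_eqOn_of_mem_rightHalf (hx : Arc γ D d a b x) (hy : Arc γ D d a b y) (hab : a < b)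
    (h0 : x a = y a) (ha : x a ∈ RightHalf) : ∃ c ∈ Ioc a b, ∀ t ∈ Icc a c, x t = y t := by
  obtain ⟨c₁, hc₁, hp₁⟩ := hx.exists_pos_of_mem_rightHalf hab ha
  obtain ⟨c₂, hc₂, hp₂⟩ := hy.exists_pos_of_mem_rightHalf hab (h0 ▸ ha)
  have hm : a ∈ Icc a b := ⟨le_rfl, hab.le⟩
  have cx1 := hx.continuousOn_fst hab.le a hm
  have cx2 := hx.continuousOn_snd hab.le a hm
  have cy1 := hy.continuousOn_fst hab.le a hm
  have cy2 := hy.continuousOn_snd hab.le a hm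
  obtain ⟨L, hL, H⟩ : ∃ L : ℝ, 0 ≤ L ∧ ∀ᶠ t in nhdsWithin a (Icc a b),
      |brake (x t) - brake (y t)| ≤ L * (|(x t).1 - (y t).1| + |(x t).2 - (y t).2|) := by
    rcases ha with h1 | ⟨-, h2⟩
    · have hM : |(x a).2| < |(x a).2| + 1 := lt_add_one _
      have hy1 : (x a).1 / 2 < (y a).1 := by rw [← h0]; exact half_lt_self h1
      have hy2 : |(y a).2| < |(x a).2| + 1 := by rw [← h0]; exact hM
      refine ⟨2 * (|(x a).2| + 1) / ((x a).1 / 2) + (|(x a).2| + 1) ^ 2 / ((x a).1 / 2) ^ 2,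
        by positivity, ?_⟩
      filter_upwards [cx1.eventually_const_lt (half_lt_self h1),
        cy1.eventually_const_lt hy1, cx2.abs.eventually_lt_const hM,
        cy2.abs.eventually_lt_const hy2] with t t1 t2 t3 t4
      exact abs_brake_sub_le (half_pos h1) t1.le t2.le t3.le t4.le
    · refine ⟨0, le_rfl, ?_⟩
      filter_upwards [cx2.eventually_const_lt h2, cy2.eventually_const_lt (h0 ▸ h2)] with t t1 t2
      rw [brake_of_nonneg t1.le, brake_of_nonneg t2.le]; simp
  rw [nhdsWithin_Icc_eq_nhdsGE hab, (nhdsGE_basis a).eventually_iff] at H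
  obtain ⟨c₃, hc₃, H⟩ := H
  obtain ⟨c, hca, hcm⟩ := exists_between (lt_min hc₁.1 (lt_min hc₂.1 hc₃))
  obtain ⟨h1, h2, h3⟩ : c < c₁ ∧ c < c₂ ∧ c < c₃ := by simpa using hcm
  have hcb := h1.le.trans hc₁.2
  refine ⟨c, ⟨hca, hcb⟩, fun t ht => ?_⟩
  have htb := ht.2.trans hcb
  exact (hx.mono le_rfl ht.1 htb).eq_of_brake_lipschitz (hy.mono le_rfl ht.1 htb) ht.1 h0 hL
    (fun τ hτ => ⟨hp₁ τ ⟨hτ.1, hτ.2.trans (ht.2.trans_lt h1)⟩,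
      hp₂ τ ⟨hτ.1, hτ.2.trans (ht.2.trans_lt h2)⟩,
      H ⟨hτ.1.le, hτ.2.trans (ht.2.trans_lt h3)⟩⟩)

/-- Forward uniqueness. -/
lemma eqOn (hx : Arc γ D d a b x) (hy : Arc γ D d a b y) (hD : 0 ≤ D) (hγ : D < γ) (hab : a ≤ b)
    (h0 : x a = y a) : EqOn x y (Icc a b) := by
  have hcont : ContinuousOn (fun t => x t - y t) (Icc a b) :=
    ((hx.continuousOn_fst hab).prodMk (hx.continuousOn_snd hab)).sub
      ((hy.continuousOn_fst hab).prodMk (hy.continuousOn_snd hab))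
  have hcl : IsClosed ({t | x t = y t} ∩ Icc a b) := by
    have := hcont.preimage_isClosed_of_isClosed isClosed_Icc (isClosed_singleton (x := 0))
    convert! this using 1
    ext t; simp [sub_eq_zero, and_comm]
  refine hcl.Icc_subset_of_forall_mem_nhdsWithin h0 (fun t ⟨hxy, hta, htb⟩ => ?_)
  have hxy : x t = y t := hxy
  have hxt := hx.mono hta htb.le le_rfl
  have hyt := hy.mono hta htb.le le_rfl
  suffices ∃ c ∈ Ioc t b, ∀ τ ∈ Icc t c, x τ = y τ by
    obtain ⟨c, hc, H⟩ := this
    exact Filter.mem_of_superset (Ioc_mem_nhdsGT hc.1) (fun τ hτ => H τ ⟨hτ.1.le, hτ.2⟩)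
  rcases eq_zero_or_mem_rightHalf (x t) with h | h | h
  · exact ⟨b, ⟨htb, le_rfl⟩, fun τ hτ => by
      rw [hxt.eq_zero hD hγ h τ hτ, hyt.eq_zero hD hγ (hxy ▸ h) τ hτ]⟩
  · exact hxt.exists_eqOn_of_mem_rightHalf hyt htb hxy h
  · obtain ⟨c, hc, H⟩ := hxt.neg.exists_eqOn_of_mem_rightHalf hyt.neg htb
      (congrArg Neg.neg hxy) h
    exact ⟨c, hc, fun τ hτ => neg_injective (H τ hτ)⟩

end Arc

/-! ### Local existence -/

/-- Truncation of the real line to `[-M, M]`. -/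
noncomputable def clip (M z : ℝ) : ℝ := max (-M) (min z M)

lemma abs_clip_le {M : ℝ} (hM : 0 ≤ M) (z : ℝ) : |clip M z| ≤ M :=
  abs_le.2 ⟨le_max_left _ _, max_le (by linarith) (min_le_right _ _)⟩

lemma abs_clip_sub_le (M z w : ℝ) : |clip M z - clip M w| ≤ |z - w| := by
  have h1 : |clip M z - clip M w| ≤ |min z M - min w M| := by
    simpa [clip] using abs_max_sub_max_le_max (-M) (min z M) (-M) (min w M)
  have h2 : |min z M - min w M| ≤ |z - w| := by simpa using abs_min_sub_min_le_max z M w M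
  exact h1.trans h2

lemma clip_of_abs_le {M z : ℝ} (h : |z| ≤ M) : clip M z = z := by
  obtain ⟨h1, h2⟩ := abs_le.1 h
  rw [clip, min_eq_left h2, max_eq_right h1]

/-- A bounded and globally Lipschitz vector field that has the closed loop as its solutions where
`x₁ ≥ ε` or `x₂ ≥ 0`, and `|x₂| ≤ M`. Its states are `(x₁, x₂ - E)` with the primitive `E` of the
disturbance, which makes it continuous in time for a merely measurable disturbance. -/
noncomputable def cutoffField (γ ε M : ℝ) (E : ℝ → ℝ) (t : ℝ) (q : ℝ × ℝ) : ℝ × ℝ :=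
  (clip M (q.2 + E t), -γ + brake (max q.1 ε, clip M (q.2 + E t)))

lemma norm_cutoffField_le (γ : ℝ) {ε M : ℝ} (E : ℝ → ℝ) (hε : 0 < ε) (hM : 0 ≤ M) (t : ℝ)
    (q : ℝ × ℝ) : ‖cutoffField γ ε M E t q‖ ≤ M + |γ| + M ^ 2 / ε := by
  have h1 := abs_clip_le hM (q.2 + E t)
  have h2 : brake (max q.1 ε, clip M (q.2 + E t)) ≤ M ^ 2 / ε := by
    have h1 : |min (clip M (q.2 + E t)) 0| ≤ M :=
      abs_min_le_max_abs_abs.trans (by simp [abs_clip_le hM])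
    have h2 := sq_le_sq' (abs_le.1 h1).1 (abs_le.1 h1).2
    have h3 : ε ≤ max q.1 ε := le_max_right _ _
    unfold brake
    gcongr
  have h3 : 0 ≤ brake (max q.1 ε, clip M (q.2 + E t)) :=
    brake_nonneg (hε.le.trans (le_max_right _ _))
  have h4 : 0 ≤ M ^ 2 / ε := by positivity
  rw [Prod.norm_def]
  refine max_le ?_ ?_
  · exact h1.trans (by linarith [abs_nonneg γ])
  · refine abs_le.2 ⟨?_, ?_⟩ <;> simp only [cutoffField] <;>
      linarith [neg_abs_le γ, le_abs_self γ]

lemma isPicardLindelof_cutoffField (γ : ℝ) {ε M a b : ℝ} {E : ℝ → ℝ} (hε : 0 < ε) (hM : 0 ≤ M)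
    (hab : a ≤ b) (hE : ContinuousOn E (Icc a b)) (p : ℝ × ℝ) :
    ∃ R L K, IsPicardLindelof (cutoffField γ ε M E) (⟨a, le_rfl, hab⟩ : Icc a b) p R 0 L K := by
  have hL : 0 ≤ M + |γ| + M ^ 2 / ε := by positivity
  have hK : 0 ≤ 1 + 2 * (2 * M / ε + M ^ 2 / ε ^ 2) := by positivity
  refine ⟨.mk _ (mul_nonneg hL (sub_nonneg.2 hab)), .mk _ hL, .mk _ hK, ⟨?_, ?_, ?_, ?_⟩⟩
  · intro t _
    refine LipschitzOnWith.of_dist_le_mul (fun q _ q' _ => ?_)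
    rw [dist_eq_norm, dist_eq_norm]
    have h1 : |q.1 - q'.1| ≤ ‖q - q'‖ := norm_fst_le (q - q')
    have h2 : |q.2 - q'.2| ≤ ‖q - q'‖ := norm_snd_le (q - q')
    have h3 : |clip M (q.2 + E t) - clip M (q'.2 + E t)| ≤ |q.2 - q'.2| :=
      (abs_clip_sub_le _ _ _).trans (by simp)
    have h4 : |max q.1 ε - max q'.1 ε| ≤ |q.1 - q'.1| := by
      simpa using abs_max_sub_max_le_max q.1 ε q'.1 ε
    have h5 := abs_brake_sub_le (p := (max q.1 ε, clip M (q.2 + E t)))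
      (q := (max q'.1 ε, clip M (q'.2 + E t))) hε (le_max_right _ _) (le_max_right _ _)
      (abs_clip_le hM _) (abs_clip_le hM _)
    have hc : 0 ≤ 2 * M / ε + M ^ 2 / ε ^ 2 := by positivity
    have h6 : (2 * M / ε + M ^ 2 / ε ^ 2) * (|max q.1 ε - max q'.1 ε| +
        |clip M (q.2 + E t) - clip M (q'.2 + E t)|) ≤
        (2 * M / ε + M ^ 2 / ε ^ 2) * (‖q - q'‖ + ‖q - q'‖) := by
      gcongr
      · exact h4.trans h1
      · exact h3.trans h2
    have hn := norm_nonneg (q - q')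
    have h7 : 0 ≤ 2 * (2 * M / ε + M ^ 2 / ε ^ 2) * ‖q - q'‖ := by positivity
    rw [NNReal.coe_mk, Prod.norm_def]
    refine max_le ?_ ?_
    · refine h3.trans (h2.trans ?_)
      linarith
    · have h8 : (cutoffField γ ε M E t q - cutoffField γ ε M E t q').2 =
          brake (max q.1 ε, clip M (q.2 + E t)) - brake (max q'.1 ε, clip M (q'.2 + E t)) := by
        simp [cutoffField]
      rw [h8, Real.norm_eq_abs]
      refine h5.trans (h6.trans ?_)
      linarith
  · intro q _
    unfold cutoffField clip brake
    refine ContinuousOn.prodMk (by fun_prop) ?_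
    refine continuousOn_const.add (ContinuousOn.div (by fun_prop) (by fun_prop) ?_)
    intro t _
    exact (hε.trans_le (le_max_right _ _)).ne'
  · intro t _ q _
    exact norm_cutoffField_le γ E hε hM t q
  · simp [max_eq_left (sub_nonneg.2 hab)]

/-- Local existence in the right half-plane. -/
lemma exists_arc_of_mem_rightHalf (γ : ℝ) {D a b : ℝ} {d : ℝ → ℝ} (hab : a < b)
    (hd : IntervalIntegrable d volume a b) (hdD : ∀ᵐ t, t ∈ Ioo a b → |d t| ≤ D) {p : ℝ × ℝ}
    (hp : p ∈ RightHalf) : ∃ c ∈ Ioc a b, ∃ x, Arc γ D d a c x ∧ x a = p := by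
  set E : ℝ → ℝ := fun t => ∫ τ in a..t, d τ with hE
  have hEac := hd.absolutelyContinuousOnInterval_intervalIntegral (c := a) (by simp)
  have hEc : ContinuousOn E (Icc a b) := uIcc_of_le hab.le ▸ hEac.continuousOn
  set M := |p.2| + 1
  have hM : 0 ≤ M := by positivity
  obtain ⟨ε, hε, hpε⟩ : ∃ ε > 0, ε < p.1 ∨ 0 < p.2 := by
    rcases hp with h | h
    · exact ⟨p.1 / 2, half_pos h, Or.inl (half_lt_self h)⟩
    · exact ⟨1, one_pos, Or.inr h.2⟩
  obtain ⟨R, L, K, hPL⟩ := isPicardLindelof_cutoffField γ hε hM hab.le hEc p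
  obtain ⟨α, hα0, hα⟩ := hPL.exists_eq_forall_mem_Icc_hasDerivWithinAt₀
  have hα0 : α a = p := hα0
  have hαd : ∀ t ∈ Ioo a b, HasDerivAt α (cutoffField γ ε M E t (α t)) t := fun t ht =>
    (hα t (Ioo_subset_Icc_self ht)).hasDerivAt (Icc_mem_nhds ht.1 ht.2)
  have hαL : LipschitzOnWith (.mk (M + |γ| + M ^ 2 / ε) (by positivity)) α (uIcc a b) :=
    uIcc_of_le hab.le ▸ (convex_Icc a b).lipschitzOnWith_of_nnnorm_hasDerivWithin_le hα
      (fun t _ => norm_cutoffField_le γ E hε hM t (α t))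
  set x : ℝ → ℝ × ℝ := fun t => ((α t).1, (α t).2 + E t) with hx
  have hxa : x a = p := by simp [hx, hα0, hE]
  have hα1 : LipschitzOnWith _ (fun t => (α t).1) (uIcc a b) :=
    LipschitzWith.prod_fst.comp_lipschitzOnWith hαL
  have hα2 : LipschitzOnWith _ (fun t => (α t).2) (uIcc a b) :=
    LipschitzWith.prod_snd.comp_lipschitzOnWith hαL
  have hx1 : AbsolutelyContinuousOnInterval (fun t => (x t).1) a b :=
    hα1.absolutelyContinuousOnInterval
  have hx2 : AbsolutelyContinuousOnInterval (fun t => (x t).2) a b :=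
    hα2.absolutelyContinuousOnInterval.fun_add hEac
  have hx1c : ContinuousOn (fun t => (x t).1) (Icc a b) := uIcc_of_le hab.le ▸ hx1.continuousOn
  have hx2c : ContinuousOn (fun t => (x t).2) (Icc a b) := uIcc_of_le hab.le ▸ hx2.continuousOn
  have ha : a ∈ Icc a b := ⟨le_rfl, hab.le⟩
  obtain ⟨c₁, hc₁, H₁⟩ : ∃ c > a, ∀ ⦃t⦄, t ∈ Ico a c → |(x t).2| < M := by
    rw [← (nhdsGE_basis a).eventually_iff, ← nhdsWithin_Icc_eq_nhdsGE hab]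
    exact (hx2c a ha).abs.eventually_lt_const (by simp [hxa, M])
  obtain ⟨c₂, hc₂, H₂⟩ : ∃ c > a, (∀ ⦃t⦄, t ∈ Ico a c → ε < (x t).1) ∨
      0 < p.2 ∧ ∀ ⦃t⦄, t ∈ Ico a c → p.2 / 2 < (x t).2 := by
    rcases hpε with h | h
    · have := (hx1c a ha).eventually_const_lt (hxa ▸ h)
      rw [nhdsWithin_Icc_eq_nhdsGE hab, (nhdsGE_basis a).eventually_iff] at this
      obtain ⟨c, hc, H⟩ := this
      exact ⟨c, hc, Or.inl H⟩
    · have := (hx2c a ha).eventually_const_lt (hxa ▸ half_lt_self h)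
      rw [nhdsWithin_Icc_eq_nhdsGE hab, (nhdsGE_basis a).eventually_iff] at this
      obtain ⟨c, hc, H⟩ := this
      exact ⟨c, hc, Or.inr ⟨h, hxa ▸ H⟩⟩
  obtain ⟨c, hac, hcm⟩ := exists_between (lt_min hc₁ (lt_min hc₂ hab))
  obtain ⟨hcc₁, hcc₂, hcb⟩ : c < c₁ ∧ c < c₂ ∧ c < b := by simpa using hcm
  have hsub : ∀ {t}, a ≤ t → t ≤ c → uIcc a t ⊆ uIcc a b := fun h h' => by
    rw [uIcc_of_le h, uIcc_of_le hab.le]; exact Icc_subset_Icc_right (h'.trans hcb.le)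
  have hd1 : ∀ t ∈ Ioo a c, HasDerivAt (fun s => (x s).1) (x t).2 t := by
    intro t ht
    have h1 := (hαd t ⟨ht.1, ht.2.trans hcb⟩).fst
    have h2 : clip M ((α t).2 + E t) = (x t).2 :=
      clip_of_abs_le (H₁ ⟨ht.1.le, ht.2.trans hcc₁⟩).le
    simpa only [cutoffField, h2] using! h1
  have hpos : ∀ t ∈ Ioo a c, 0 < (x t).1 ∧ (ε < (x t).1 ∨ 0 ≤ (x t).2) := by
    intro t ht
    rcases H₂ with H₂ | ⟨hp2, H₂⟩
    · have := H₂ ⟨ht.1.le, ht.2.trans hcc₂⟩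
      exact ⟨hε.trans this, Or.inl this⟩
    · refine ⟨?_, Or.inr ((half_pos hp2).trans (H₂ ⟨ht.1.le, ht.2.trans hcc₂⟩)).le⟩
      have h1 := le_sub_of_ae_le_hasDerivAt (c := p.2 / 2) ht.1.le (hx1.mono (hsub ht.1.le ht.2.le))
        (Filter.Eventually.of_forall fun τ hτ => ⟨_,
          (H₂ ⟨hτ.1.le, (hτ.2.trans ht.2).trans hcc₂⟩).le, hd1 τ ⟨hτ.1, hτ.2.trans ht.2⟩⟩)
      have h2 : 0 ≤ p.1 := by
        rcases hp with h | h
        · exact h.le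
        · exact h.1.ge
      have h3 : 0 < p.2 / 2 * (t - a) := mul_pos (half_pos hp2) (by linarith [ht.1])
      rw [hxa] at h1
      linarith
  refine ⟨c, ⟨hac, hcb.le⟩, x, ⟨hx1.mono (hsub hac.le le_rfl), hx2.mono (hsub hac.le le_rfl), ?_⟩,
    hxa⟩
  filter_upwards [hdD, hd.ae_hasDerivAt_integral] with t hdt hEt ht
  have htb : t ∈ Ioo a b := ⟨ht.1, ht.2.trans hcb⟩
  refine ⟨hd1 t ht, ⟨_, (mem_control_iff_of_pos (hpos t ht).1).2 rfl, ?_⟩, hdt htb⟩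
  have h0 : HasDerivAt (fun s => (α s).2) (cutoffField γ ε M E t (α t)).2 t :=
    (ContinuousLinearMap.snd ℝ ℝ ℝ).hasFDerivAt.comp_hasDerivAt t (hαd t htb)
  have h1 := h0.fun_add
    (hEt (by rw [uIcc_of_le hab.le]; exact Ioo_subset_Icc_self htb) a (by simp))
  have h2 : clip M ((α t).2 + E t) = (x t).2 :=
    clip_of_abs_le (H₁ ⟨ht.1.le, ht.2.trans hcc₁⟩).le
  have h3 : brake (max (α t).1 ε, (x t).2) = brake (x t) := by
    rcases (hpos t ht).2 with h | h
    · rw [max_eq_left (show ε ≤ (α t).1 from h.le)]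
    · rw [brake_of_nonneg (p := x t) h, brake_of_nonneg (p := (max (α t).1 ε, (x t).2)) h]
  simpa only [cutoffField, h2, h3] using! h1

/-! ### Global existence -/

namespace Arc

variable {γ D a b c : ℝ} {d : ℝ → ℝ} {x y : ℝ → ℝ × ℝ}

protected lemma congr (hx : Arc γ D d a b x) (hab : a ≤ b) (h : EqOn y x (Icc a b)) :
    Arc γ D d a b y := by
  have h' : EqOn y x (uIcc a b) := uIcc_of_le hab ▸ h
  refine ⟨absolutelyContinuousOnInterval_congr hx.fst fun t ht => congrArg Prod.fst (h' ht),
    absolutelyContinuousOnInterval_congr hx.snd fun t ht => congrArg Prod.snd (h' ht), ?_⟩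
  filter_upwards [hx.ode] with t ht hm
  obtain ⟨h1, ⟨u, hu, h2⟩, h3⟩ := ht hm
  have hev : y =ᶠ[nhds t] x :=
    Filter.mem_of_superset (Icc_mem_nhds hm.1 hm.2) h
  have hyx := hev.eq_of_nhds
  rw [hyx]
  exact ⟨h1.congr_of_eventuallyEq (hev.fun_comp Prod.fst),
    ⟨u, hu, h2.congr_of_eventuallyEq (hev.fun_comp Prod.snd)⟩, h3⟩

lemma concat (hx : Arc γ D d a b x) (hy : Arc γ D d b c y) (hab : a ≤ b) (hbc : b ≤ c)
    (hxy : x b = y b) : Arc γ D d a c (fun t => if t ≤ b then x t else y t) := by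
  refine ⟨?_, ?_, ?_⟩
  · simpa only [apply_ite Prod.fst] using
      absolutelyContinuousOnInterval_concat hab hbc hx.fst hy.fst (congrArg Prod.fst hxy)
  · simpa only [apply_ite Prod.snd] using
      absolutelyContinuousOnInterval_concat hab hbc hx.snd hy.snd (congrArg Prod.snd hxy)
  filter_upwards [hx.ode, hy.ode, Measure.ae_ne volume b] with t htx hty hne hm
  rcases lt_or_gt_of_ne hne with hlt | hgt
  · have hev : (fun t => if t ≤ b then x t else y t) =ᶠ[nhds t] x := by
      filter_upwards [Iio_mem_nhds hlt] with τ hτ using if_pos (le_of_lt hτ)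
    obtain ⟨h1, ⟨u, hu, h2⟩, h3⟩ := htx ⟨hm.1, hlt⟩
    simp only [if_pos hlt.le]
    exact ⟨h1.congr_of_eventuallyEq (hev.fun_comp Prod.fst),
      ⟨u, hu, h2.congr_of_eventuallyEq (hev.fun_comp Prod.snd)⟩, h3⟩
  · have hev : (fun t => if t ≤ b then x t else y t) =ᶠ[nhds t] y := by
      filter_upwards [Ioi_mem_nhds hgt] with τ hτ using if_neg (not_le.2 hτ)
    obtain ⟨h1, ⟨u, hu, h2⟩, h3⟩ := hty ⟨hgt, hm.2⟩
    simp only [if_neg (not_le.2 hgt)]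
    exact ⟨h1.congr_of_eventuallyEq (hev.fun_comp Prod.fst),
      ⟨u, hu, h2.congr_of_eventuallyEq (hev.fun_comp Prod.snd)⟩, h3⟩

end Arc

/-- At the origin the discontinuous term cancels every admissible disturbance. -/
lemma arc_zero {γ D a b : ℝ} {d : ℝ → ℝ} (hD : 0 ≤ D) (hγ : D < γ)
    (hd : ∀ᵐ t, t ∈ Ioo a b → |d t| ≤ D) : Arc γ D d a b 0 := by
  have h0 : AbsolutelyContinuousOnInterval (fun _ : ℝ => (0 : ℝ)) a b :=
    (LipschitzWith.const (0 : ℝ)).lipschitzOnWith.absolutelyContinuousOnInterval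
  refine ⟨h0, h0, ?_⟩
  filter_upwards [hd] with t ht hm
  have hγ0 : 0 < γ := by linarith
  refine ⟨hasDerivAt_const t 0, ⟨-d t, ⟨d t / γ, ?_, ?_⟩, ?_⟩, ht hm⟩
  · simp only [setSign, Pi.zero_apply, Prod.fst_zero, if_true]
    rw [mem_Icc, ← abs_le, abs_div, abs_of_pos hγ0, div_le_one hγ0]
    exact (ht hm).trans hγ.le
  · simp [damping]; field_simp
  · rw [neg_add_cancel]; exact hasDerivAt_const t 0

/-- Solutions on the intervals `[a, τ]`, `τ ∈ I`, fit together to one function. The map `g` picks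
for each time an interval that contains it. -/
lemma exists_glued_arc {γ D a : ℝ} {d : ℝ → ℝ} (hD : 0 ≤ D) (hγ : D < γ) {p : ℝ × ℝ} {I : Set ℝ}
    (hI : ∀ τ ∈ I, a ≤ τ) (g : ℝ → ℝ) (hg : ∀ τ ∈ I, ∀ t ∈ Icc a τ, g t ∈ I ∧ t ≤ g t)
    (h : ∀ τ ∈ I, ∃ x, Arc γ D d a τ x ∧ x a = p) :
    ∃ x, ∀ τ ∈ I, Arc γ D d a τ x ∧ x a = p := by
  choose! z hz using h
  refine ⟨fun t => z (g t) t, fun τ hτ => ?_⟩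
  have heq : EqOn (fun t => z (g t) t) (z τ) (Icc a τ) := by
    intro t ht
    obtain ⟨hgI, htg⟩ := hg τ hτ t ht
    exact ((hz _ hgI).1.mono le_rfl ht.1 htg).eqOn ((hz _ hτ).1.mono le_rfl ht.1 ht.2) hD hγ ht.1
      ((hz _ hgI).2.trans (hz _ hτ).2.symm) ⟨ht.1, le_rfl⟩
  exact ⟨(hz τ hτ).1.congr (hI τ hτ) heq, (heq ⟨le_rfl, hI τ hτ⟩).trans (hz τ hτ).2⟩

/-- A Lipschitz solution on `[a, T)` extends to `[a, T]`. -/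
lemma exists_arc_Icc_of_Ico {γ D a T : ℝ} {d : ℝ → ℝ} {x : ℝ → ℝ × ℝ} (haT : a < T)
    (h : ∀ τ ∈ Ioo a T, Arc γ D d a τ x) {B : ℝ} (hB : 0 ≤ B)
    (hlip : ∀ s t, a ≤ s → s ≤ t → t < T →
      |(x t).1 - (x s).1| ≤ B * (t - s) ∧ |(x t).2 - (x s).2| ≤ B * (t - s)) :
    ∃ y, Arc γ D d a T y ∧ y a = x a := by
  have hl : ∀ f : ℝ → ℝ, (∀ s t, a ≤ s → s ≤ t → t < T → |f t - f s| ≤ B * (t - s)) →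
      LipschitzOnWith (.mk B hB) f (Ico a T) := by
    intro f hf
    refine LipschitzOnWith.of_dist_le_mul (fun s hs t ht => ?_)
    rw [Real.dist_eq, Real.dist_eq, NNReal.coe_mk]
    rcases le_total s t with hst | hst
    · rw [abs_sub_comm, abs_sub_comm s, abs_of_nonneg (sub_nonneg.2 hst)]
      exact hf s t hs.1 hst ht.2
    · rw [abs_of_nonneg (sub_nonneg.2 hst)]
      exact hf t s ht.1 hst hs.2
  obtain ⟨y₁, hy₁, e₁⟩ :=
    (hl (fun t => (x t).1) fun s t h1 h2 h3 => (hlip s t h1 h2 h3).1).extend_real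
  obtain ⟨y₂, hy₂, e₂⟩ :=
    (hl (fun t => (x t).2) fun s t h1 h2 h3 => (hlip s t h1 h2 h3).2).extend_real
  have hyx : EqOn (fun t => (y₁ t, y₂ t)) x (Ico a T) := fun t ht =>
    Prod.ext (e₁ ht).symm (e₂ ht).symm
  refine ⟨fun t => (y₁ t, y₂ t), ⟨hy₁.lipschitzOnWith.absolutelyContinuousOnInterval,
    hy₂.lipschitzOnWith.absolutelyContinuousOnInterval, ?_⟩, hyx (left_mem_Ico.2 haT)⟩
  refine ae_of_mem_of_ae_of_mem_inter_Ioo (fun s t hs ht hst => ?_)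
  have hA := (h t ht).congr ht.1.le (hyx.mono (Icc_subset_Ico_right ht.2))
  filter_upwards [hA.ode] with τ hτ hm
  exact hτ ⟨hm.1.1, hm.2.2⟩

/-- Along solutions that stay away from the origin, the velocity and the acceleration are bounded
in terms of the initial state and the duration. -/
lemma exists_lipschitz_bound {γ D : ℝ} (hD : 0 ≤ D) (hγ : D < γ) (a T : ℝ) {p : ℝ × ℝ}
    (hp : p ∈ RightHalf) : ∃ B : ℝ, 0 ≤ B ∧ ∀ (d : ℝ → ℝ) (x : ℝ → ℝ × ℝ) (b : ℝ), b ≤ T →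
      Arc γ D d a b x → x a = p → (∀ t ∈ Icc a b, x t ≠ 0) → ∀ s t, a ≤ s → s ≤ t → t ≤ b →
      |(x t).1 - (x s).1| ≤ B * (t - s) ∧ |(x t).2 - (x s).2| ≤ B * (t - s) := by
  obtain ⟨K, hK0, hK, hpK⟩ : ∃ K, 0 ≤ K ∧ 2 * (γ + D) ≤ K ∧ (min p.2 0) ^ 2 ≤ K * p.1 := by
    refine ⟨max (2 * (γ + D)) (brake p), le_max_of_le_left (by linarith), le_max_left _ _, ?_⟩
    rcases hp with h | ⟨h, h'⟩
    · exact (div_le_iff₀ h).1 (le_max_right (2 * (γ + D)) (brake p))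
    · rw [min_eq_right h'.le, h]; simp
  set B₂ := γ + D + K with hB₂
  have hB₂0 : 0 ≤ B₂ := by linarith
  set B₁ := |p.2| + B₂ * |T - a|
  have hB₁0 : 0 ≤ B₁ := by positivity
  refine ⟨B₁ + B₂, by positivity, fun d x b hbT h hxa hne s t has hst htb => ?_⟩
  have hab := has.trans (hst.trans htb)
  have hpos := h.pos_of_mem_rightHalf hD hγ (hxa ▸ hp) hne
  have hpos' : ∀ t ∈ Ioo a b, 0 < (x t).1 := fun t ht => hpos t (Ioo_subset_Ioc_self ht)
  have hbr : ∀ t ∈ Ioo a b, brake (x t) ≤ K := fun t ht =>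
    (div_le_iff₀ (hpos' t ht)).2
      (h.min_sq_le hab hpos' hK0 hK (hxa ▸ hpK) t (Ioo_subset_Icc_self ht))
  have h2 : ∀ s t, a ≤ s → s ≤ t → t ≤ b → |(x t).2 - (x s).2| ≤ B₂ * (t - s) := by
    intro s t has hst htb
    have hsub : Ioo s t ⊆ Ioo a b := Ioo_subset_Ioo has htb
    have h' := h.mono has hst htb
    have h3 := h'.snd_sub_le hst (fun τ hτ => hpos' τ (hsub hτ)) (fun τ hτ => hbr τ (hsub hτ))
    have h4 := h'.le_snd_sub hst (fun τ hτ => hpos' τ (hsub hτ))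
    have h5 : 0 ≤ t - s := by linarith
    refine abs_le.2 ⟨?_, ?_⟩ <;> nlinarith
  have h3 : ∀ τ ∈ Icc a b, |(x τ).2| ≤ B₁ := by
    intro τ hτ
    have h4 := h2 a τ le_rfl hτ.1 hτ.2
    have h5 : B₂ * (τ - a) ≤ B₂ * |T - a| := by
      gcongr
      exact (by linarith [hτ.2] : τ - a ≤ T - a).trans (le_abs_self _)
    have h6 : |(x τ).2| ≤ |(x τ).2 - (x a).2| + |(x a).2| := by
      simpa using abs_add_le ((x τ).2 - (x a).2) (x a).2
    rw [hxa] at h4 h6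
    linarith
  have h' := h.mono has hst htb
  have h5 : 0 ≤ t - s := by linarith
  have hI : ∀ τ ∈ Ioo s t, τ ∈ Icc a b := fun τ hτ =>
    ⟨has.trans hτ.1.le, hτ.2.le.trans htb⟩
  have h6 := h'.fst_sub_le hst (fun τ hτ => (abs_le.1 (h3 τ (hI τ hτ))).2)
  have h7 := h'.le_fst_sub hst (fun τ hτ => (abs_le.1 (h3 τ (hI τ hτ))).1)
  have h8 := h2 s t has hst htb
  have h9 : 0 ≤ B₁ * (t - s) := by positivity
  have h10 : 0 ≤ B₂ * (t - s) := by positivity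
  exact ⟨abs_le.2 ⟨by linarith, by linarith⟩, h8.trans (by linarith)⟩

namespace IsDisturbance

variable {D : ℝ} {d : ℝ → ℝ}

protected lemma neg (hd : IsDisturbance D d) : IsDisturbance D (-d) :=
  ⟨hd.measurable.neg, by filter_upwards [hd.bound] with t ht; simpa using ht⟩

lemma ae_bound (hd : IsDisturbance D d) {a b : ℝ} (ha : 0 ≤ a) :
    ∀ᵐ t, t ∈ Ioo a b → |d t| ≤ D := by
  filter_upwards [(ae_restrict_iff' measurableSet_Ici).1 hd.bound] with t ht hm
  exact ht (ha.trans hm.1.le)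

lemma intervalIntegrable (hd : IsDisturbance D d) {a b : ℝ} (ha : 0 ≤ a) (hab : a ≤ b) :
    IntervalIntegrable d volume a b := by
  rw [intervalIntegrable_iff_integrableOn_Icc_of_le hab]
  have hsub : Icc a b ⊆ Ici 0 := fun t ht => ha.trans ht.1
  exact IntegrableOn.of_bound (by simp) (hd.measurable.mono_set hsub).aestronglyMeasurable D
    (ae_restrict_of_ae_restrict_of_subset hsub hd.bound)

end IsDisturbance

/-- Existence on every bounded interval: a solution that does not reach the origin is Lipschitz up
to the supremum of the times for which it exists, and continues beyond it; a solution that reaches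
the origin continues by zero. -/
lemma exists_arc_Icc {γ D : ℝ} {d : ℝ → ℝ} (hD : 0 ≤ D) (hγ : D < γ) (hd : IsDisturbance D d)
    {p : ℝ × ℝ} (hp : p ∈ RightHalf) {T : ℝ} (hT : 0 < T) : ∃ x, Arc γ D d 0 T x ∧ x 0 = p := by
  by_contra hno
  have hne : ∀ τ ≤ T, ∀ x, Arc γ D d 0 τ x → x 0 = p → ∀ t ∈ Icc 0 τ, x t ≠ 0 := by
    intro τ hτT x hx hx0 t ht h0
    have htT := ht.2.trans hτT
    refine hno ⟨_, (hx.mono le_rfl ht.1 ht.2).concat (c := T)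
      (arc_zero hD hγ (hd.ae_bound ht.1)) ht.1 htT h0, ?_⟩
    simp [ht.1, hx0]
  set S := {τ | 0 < τ ∧ ∃ x, Arc γ D d 0 τ x ∧ x 0 = p} with hS
  have hSne : S.Nonempty := by
    obtain ⟨c, hc, x, hx, hx0⟩ := exists_arc_of_mem_rightHalf γ hT
      (hd.intervalIntegrable le_rfl hT.le) (hd.ae_bound le_rfl) hp
    exact ⟨c, hc.1, x, hx, hx0⟩
  have hSlt : ∀ τ ∈ S, τ < T := by
    rintro τ ⟨hτ, x, hx, hx0⟩
    by_contra! hle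
    exact hno ⟨x, hx.mono le_rfl hT.le hle, hx0⟩
  have hSb : BddAbove S := ⟨T, fun τ hτ => (hSlt τ hτ).le⟩
  set σ := sSup S with hσ
  have hσT : σ ≤ T := csSup_le hSne fun τ hτ => (hSlt τ hτ).le
  have hσ0 : 0 < σ := by
    obtain ⟨τ, hτ⟩ := hSne
    exact hτ.1.trans_le (le_csSup hSb hτ)
  have hbelow : ∀ τ ∈ Ioo 0 σ, ∃ x, Arc γ D d 0 τ x ∧ x 0 = p := by
    intro τ hτ
    obtain ⟨τ', ⟨-, x, hx, hx0⟩, hlt⟩ := exists_lt_of_lt_csSup hSne hτ.2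
    exact ⟨x, hx.mono le_rfl hτ.1.le hlt.le, hx0⟩
  obtain ⟨x, hx⟩ := exists_glued_arc (I := Ioo 0 σ) hD hγ (fun τ hτ => hτ.1.le) (fun t => (t + σ) / 2)
    (fun τ hτ t ht => ⟨⟨by linarith [ht.1], by linarith [ht.2, hτ.2]⟩, by linarith [ht.2, hτ.2]⟩)
    hbelow
  obtain ⟨B, hB, hBx⟩ := exists_lipschitz_bound hD hγ 0 T hp
  obtain ⟨y, hy, hy0⟩ := exists_arc_Icc_of_Ico hσ0 (fun τ hτ => (hx τ hτ).1) hB (by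
    intro s t hs hst htσ
    obtain ⟨τ, hτ1, hτ2⟩ := exists_between (max_lt htσ hσ0)
    have hτ : τ ∈ Ioo 0 σ := ⟨(le_max_right _ _).trans_lt hτ1, hτ2⟩
    obtain ⟨h1, h2⟩ := hx τ hτ
    exact hBx d x τ (hτ2.le.trans hσT) h1 h2 (hne τ (hτ2.le.trans hσT) x h1 h2) s t hs hst
      ((le_max_left _ _).trans hτ1.le))
  have hy0 : y 0 = p := hy0.trans (hx (σ / 2) ⟨by linarith, by linarith⟩).2
  have hyσ : y σ ∈ RightHalf := Or.inl
    (hy.pos_of_mem_rightHalf hD hγ (hy0 ▸ hp) (hne σ hσT y hy hy0) σ ⟨hσ0, le_rfl⟩)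
  obtain ⟨c, hc, z, hz, hzσ⟩ := exists_arc_of_mem_rightHalf γ (lt_add_one σ)
    (hd.intervalIntegrable hσ0.le (lt_add_one σ).le) (hd.ae_bound hσ0.le) hyσ
  have hcS : c ∈ S := ⟨hσ0.trans hc.1, _, hy.concat hz hσ0.le hc.1.le hzσ.symm, by
    simp [hσ0.le, hy0]⟩
  exact absurd (le_csSup hSb hcS) (not_le.2 hc.1)

/-! ### Solutions and trajectories of the closed loop -/

lemma IsSolutionOn.arc {γ D T : ℝ} {d : ℝ → ℝ} {x : ℝ → ℝ × ℝ} (h : IsSolutionOn γ d T x)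
    (hd : IsDisturbance D d) : Arc γ D d 0 T x := by
  refine ⟨h.absCont_fst, h.absCont_snd, ?_⟩
  filter_upwards [(ae_restrict_iff' measurableSet_Icc).1 h.ode, hd.ae_bound (b := T) le_rfl]
    with t ht hb hm
  obtain ⟨h1, h2⟩ := ht (Ioo_subset_Icc_self hm)
  exact ⟨h1, h2, hb hm⟩

lemma Arc.isSolutionOn {γ D T : ℝ} {d : ℝ → ℝ} {x : ℝ → ℝ × ℝ} (h : Arc γ D d 0 T x) :
    IsSolutionOn γ d T x := by
  refine ⟨h.fst, h.snd, ?_⟩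
  rw [← Measure.restrict_congr_set Ioo_ae_eq_Icc, ae_restrict_iff' measurableSet_Ioo]
  filter_upwards [h.ode] with t ht hm
  exact ⟨(ht hm).1, (ht hm).2.1⟩

lemma IsTrajectory.arc {γ D : ℝ} {d : ℝ → ℝ} {x : ℝ → ℝ × ℝ} (h : IsTrajectory γ d x)
    (hd : IsDisturbance D d) {b : ℝ} (hb : 0 ≤ b) : Arc γ D d 0 b x :=
  ((h (b + 1) (by linarith)).arc hd).mono le_rfl hb (by linarith)

/-- The problem is well-posed from every state. -/
theorem wellPosedFrom {γ D : ℝ} {d : ℝ → ℝ} (hD : 0 ≤ D) (hγ : D < γ) (hd : IsDisturbance D d)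
    (p : ℝ × ℝ) : WellPosedFrom γ d p := by
  have hex : ∀ T ∈ Ioi (0 : ℝ), ∃ x, Arc γ D d 0 T x ∧ x 0 = p := by
    intro T hT
    rcases eq_zero_or_mem_rightHalf p with h | h | h
    · exact ⟨0, arc_zero hD hγ (hd.ae_bound le_rfl), h.symm⟩
    · exact exists_arc_Icc hD hγ hd h hT
    · obtain ⟨x, hx, hx0⟩ := exists_arc_Icc hD hγ hd.neg h hT
      exact ⟨-x, by simpa using hx.neg, by simp [hx0]⟩
  obtain ⟨x, hx⟩ := exists_glued_arc (I := Ioi 0) hD hγ (fun τ hτ => le_of_lt hτ) (fun t => t + 1)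
    (fun τ hτ t ht => ⟨by have := ht.1; simp only [mem_Ioi]; linarith, by linarith⟩) hex
  refine ⟨x, fun T hT => (hx T hT).1.isSolutionOn, (hx 1 (mem_Ioi.2 one_pos)).2,
    fun T y hT hy hy0 => ?_⟩
  exact (hy.arc hd).eqOn (hx T hT).1 hD hγ hT.le (hy0.trans (hx T hT).2.symm)

lemma snd_nonneg_of_mem_rightHalf {p : ℝ × ℝ} (hp : p ∈ RightHalf) (hU : p ∈ U) : 0 ≤ p.2 := by
  have hU : 0 ≤ p.1 * p.2 := hU
  rcases hp with h | h
  · exact nonneg_of_mul_nonneg_right hU h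
  · exact h.2.le

lemma neg_mem_U {p : ℝ × ℝ} : -p ∈ U ↔ p ∈ U := by simp [U]

lemma neg_mem_C {p : ℝ × ℝ} : -p ∈ C ↔ p ∈ C := by simp [C]

/-- From the first quadrant, the trajectory turns into the fourth one when `x₂` vanishes. -/
lemma exists_leavesUAt {γ D : ℝ} {d : ℝ → ℝ} (hD : 0 ≤ D) (hγ : D < γ) {x : ℝ → ℝ × ℝ}
    (hx : ∀ b, 0 ≤ b → Arc γ D d 0 b x) (h0 : x 0 ∈ RightHalf) (h2 : 0 ≤ (x 0).2) :
    ∃ T, LeavesUAt x T ∧ (x 0).2 / (γ + D) ≤ T ∧ T ≤ (x 0).2 / (γ - D) ∧ 0 < (x T).1 ∧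
      (x T).2 = 0 ∧ (x T).1 ≤ (x 0).1 + (x 0).2 * T := by
  have hm : 0 < γ - D := by linarith
  have hq : 0 ≤ (x 0).2 / (γ - D) := by positivity
  set b := (x 0).2 / (γ - D) + 1
  have hb := hx b (by positivity)
  obtain ⟨s, hs, hU, hs2, hs1, hle, hlo, hup⟩ := hb.exists_turn hD hγ h0 h2 (by simp [b])
  rw [sub_zero] at hle hlo hup
  refine ⟨s, ⟨hs.1, fun t ht => mul_nonneg (hU t ht).1 (hU t ht).2, ?_⟩, hlo, hup, hs1, hs2, hle⟩
  have hsb := hb.mono hs.1 hs.2.le le_rfl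
  have := (hsb.continuousOn_fst hs.2.le s ⟨le_rfl, hs.2.le⟩).eventually_const_lt hs1
  rw [nhdsWithin_Icc_eq_nhdsGE hs.2, (nhdsGE_basis s).eventually_iff] at this
  obtain ⟨c, hc, H⟩ := this
  refine ⟨min c b - s, sub_pos.2 (lt_min hc hs.2), fun t ht => ?_⟩
  have htm : t < min c b := by linarith [ht.2]
  have htc := htm.trans_le (min_le_left _ _)
  have htb := htm.trans_le (min_le_right _ _)
  have hpos : ∀ τ ∈ Icc s t, 0 < (x τ).1 := fun τ hτ => H ⟨hτ.1, hτ.2.trans_lt htc⟩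
  exact mul_neg_of_pos_of_neg (hpos t ⟨ht.1.le, le_rfl⟩)
    ((hsb.mono le_rfl ht.1.le htb.le).snd_neg hγ hpos hs2.le t ⟨ht.1, le_rfl⟩)

/-- A trajectory that starts in the open fourth quadrant stays there until it is at the origin,
and `x₁` and `x₂² / x₁` are controlled by the initial state. -/
lemma Arc.fourth_quadrant {γ D b : ℝ} {d : ℝ → ℝ} {x : ℝ → ℝ × ℝ} (h : Arc γ D d 0 b x)
    (hD : 0 ≤ D) (hγ : D < γ) (hb : 0 ≤ b) (h1 : 0 < (x 0).1) (h2 : (x 0).2 < 0)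
    (hne : x b ≠ 0) : 0 < (x b).1 ∧ (x b).2 < 0 ∧ (x b).1 ≤ (x 0).1 ∧
      (x b).2 ^ 2 ≤ max (2 * (γ + D) * (x 0).1) ((x 0).2 ^ 2) := by
  have hne' : ∀ t ∈ Icc 0 b, x t ≠ 0 := fun t ht h0 =>
    hne ((h.mono ht.1 ht.2 le_rfl).eq_zero hD hγ h0 b ⟨ht.2, le_rfl⟩)
  have hpos : ∀ t ∈ Icc 0 b, 0 < (x t).1 := by
    intro t ht
    rcases ht.1.eq_or_lt with rfl | hlt
    · exact h1
    · exact h.pos_of_mem_rightHalf hD hγ (Or.inl h1) hne' t ⟨hlt, ht.2⟩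
  have hpos' : ∀ t ∈ Ioo 0 b, 0 < (x t).1 := fun t ht => hpos t (Ioo_subset_Icc_self ht)
  have hneg : (x b).2 < 0 := by
    rcases hb.eq_or_lt with rfl | hlt
    · exact h2
    · exact h.snd_neg hγ hpos h2.le b ⟨hlt, le_rfl⟩
  have hb1 := hpos b ⟨hb, le_rfl⟩
  have hle : (x b).1 ≤ (x 0).1 := by
    have := h.fst_sub_le hb (c := 0) (fun t ht =>
      h.snd_nonpos hγ hb hpos' h2.le t (Ioo_subset_Icc_self ht))
    linarith
  refine ⟨hb1, hneg, hle, ?_⟩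
  set K := max (2 * (γ + D)) (brake (x 0)) with hK
  have hK0 : 0 ≤ K := le_max_of_le_left (by linarith)
  have := h.min_sq_le hb hpos' hK0 (le_max_left _ _)
    ((div_le_iff₀ h1).1 (le_max_right _ _)) b ⟨hb, le_rfl⟩
  rw [min_eq_left hneg.le] at this
  calc (x b).2 ^ 2 ≤ K * (x b).1 := this
    _ ≤ K * (x 0).1 := by gcongr
    _ = _ := by
      rw [hK, max_mul_of_nonneg _ _ h1.le, brake_of_nonpos h2.le, div_mul_cancel₀ _ h1.ne']

/-- A time after which every trajectory from the ball of radius `r` rests at the origin: the sum of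
bounds for the ascent and for the descent. -/
noncomputable def settlingTime (γ D r : ℝ) : ℝ :=
  r / (γ - D) + 3 * √((r + r * (r / (γ - D))) / ((γ - D) / 2)) + 1

lemma eq_zero_of_settlingTime_le {γ D r : ℝ} {d : ℝ → ℝ} (hD : 0 ≤ D) (hγ : D < γ)
    {x : ℝ → ℝ × ℝ} (hx : ∀ b, 0 ≤ b → Arc γ D d 0 b x) (h0 : x 0 ∈ RightHalf) (hr : ‖x 0‖ ≤ r)
    {t : ℝ} (ht : settlingTime γ D r ≤ t) : x t = 0 := by
  by_contra hne
  have hm : 0 < γ - D := by linarith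
  have hr0 : 0 ≤ r := (norm_nonneg _).trans hr
  have hr1 : (x 0).1 ≤ r := (le_abs_self _).trans ((norm_fst_le (x 0)).trans hr)
  have hr2 : (x 0).2 ≤ r := (le_abs_self _).trans ((norm_snd_le (x 0)).trans hr)
  have hq0 : 0 ≤ r / (γ - D) := by positivity
  set R := r + r * (r / (γ - D)) with hR
  have hrR : r ≤ R := by rw [hR]; have := mul_nonneg hr0 hq0; linarith
  have hs0 := Real.sqrt_nonneg (R / ((γ - D) / 2))
  unfold settlingTime at ht
  have ht0 : 0 ≤ t := by linarith
  obtain ⟨s, hs, hsr, hs1, hs2, hsR⟩ : ∃ s, 0 ≤ s ∧ s ≤ r / (γ - D) ∧ 0 < (x s).1 ∧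
      (x s).2 ≤ 0 ∧ (x s).1 ≤ R := by
    rcases le_or_gt (x 0).2 0 with h2 | h2
    · refine ⟨0, le_rfl, hq0, ?_, h2, hr1.trans hrR⟩
      rcases h0 with h | h
      · exact h
      · exact absurd h.2 (not_lt.2 h2)
    · obtain ⟨s, hU, -, hs, hs1, hs2, hle⟩ := exists_leavesUAt hD hγ hx h0 h2.le
      have hsr : s ≤ r / (γ - D) := hs.trans (by gcongr)
      refine ⟨s, hU.1, hsr, hs1, hs2.le, hle.trans ?_⟩
      have := hU.1
      rw [hR]
      gcongr
  have hst : s ≤ t := by linarith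
  have h := (hx t ht0).mono hs hst le_rfl
  have hne' : ∀ τ ∈ Icc s t, x τ ≠ 0 := fun τ hτ h0 =>
    hne ((h.mono hτ.1 hτ.2 le_rfl).eq_zero hD hγ h0 t ⟨hτ.2, le_rfl⟩)
  have hpos : ∀ τ ∈ Icc s t, 0 < (x τ).1 := by
    intro τ hτ
    rcases hτ.1.eq_or_lt with rfl | hlt
    · exact hs1
    · exact h.pos_of_mem_rightHalf hD hγ (Or.inl hs1) hne' τ ⟨hlt, hτ.2⟩
  have := h.descent_time_le hγ hst hpos
    (h.snd_nonpos hγ hst (fun τ hτ => hpos τ (Ioo_subset_Icc_self hτ)) hs2) hsR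
  linarith

theorem uniformlyFiniteTimeAttractiveOn {γ D : ℝ} (hD : 0 ≤ D) (hγ : D < γ) (S : Set (ℝ × ℝ)) :
    UniformlyFiniteTimeAttractiveOn γ D S := by
  intro r hr
  have hm : 0 < γ - D := by linarith
  have hT : 0 ≤ settlingTime γ D r := by unfold settlingTime; positivity
  refine ⟨settlingTime γ D r, hT, fun d hd x hx _ hxr t ht => ?_⟩
  have ht0 := hT.trans ht
  rcases eq_zero_or_mem_rightHalf (x 0) with h | h | h
  · exact (hx.arc hd ht0).eq_zero hD hγ h t ⟨ht0, le_rfl⟩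
  · exact eq_zero_of_settlingTime_le hD hγ (fun b hb => hx.arc hd hb) h hxr ht
  · have := eq_zero_of_settlingTime_le hD hγ (fun b hb => (hx.arc hd hb).neg) h
      (by simpa using hxr) ht
    simpa using this

/-- Up to the symmetry `x ↦ -x`, a state in `C` is in the fourth quadrant. -/
lemma fourth_quadrant_of_mem_C {p : ℝ × ℝ} (hp : p ∈ C) :
    0 < p.1 ∧ p.2 < 0 ∨ 0 < (-p).1 ∧ (-p).2 < 0 := by
  have hp : p.1 * p.2 < 0 := hp
  rcases mul_neg_iff.1 hp with h | h
  · exact Or.inl h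
  · exact Or.inr ⟨by simpa using h.1, by simpa using h.2⟩

theorem forwardInvariant {γ D : ℝ} (hD : 0 ≤ D) (hγ : D < γ) :
    ForwardInvariant γ D (C ∪ {0}) := by
  intro d hd x hx h0 t ht
  by_cases hne : x t = 0
  · exact Or.inr hne
  left
  have h := hx.arc hd ht
  rcases h0 with h0 | h0
  · rcases fourth_quadrant_of_mem_C h0 with ⟨h1, h2⟩ | ⟨h1, h2⟩
    · obtain ⟨h3, h4, -⟩ := h.fourth_quadrant hD hγ ht h1 h2 hne
      exact mul_neg_of_pos_of_neg h3 h4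
    · obtain ⟨h3, h4, -⟩ := h.neg.fourth_quadrant hD hγ ht h1 h2 (neg_ne_zero.2 hne)
      exact neg_mem_C.1 (mul_neg_of_pos_of_neg h3 h4)
  · exact absurd (h.eq_zero hD hγ h0 t ⟨ht, le_rfl⟩) hne

theorem uniformlyStableOn {γ D : ℝ} (hD : 0 ≤ D) (hγ : D < γ) :
    UniformlyStableOn γ D (C ∪ {0}) := by
  intro ε hε
  have hp : 0 < 2 * (γ + D) := by linarith
  refine ⟨min ε (ε ^ 2 / (2 * (γ + D))), by positivity, fun d hd x hx h0 hη t ht => ?_⟩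
  have key : ∀ {d : ℝ → ℝ} {x : ℝ → ℝ × ℝ}, Arc γ D d 0 t x → 0 < (x 0).1 → (x 0).2 < 0 →
      ‖x 0‖ ≤ min ε (ε ^ 2 / (2 * (γ + D))) → ‖x t‖ ≤ ε := by
    intro d x h h1 h2 hη
    by_cases hne : x t = 0
    · rw [hne, norm_zero]; exact hε.le
    obtain ⟨h3, h4, h5, h6⟩ := h.fourth_quadrant hD hγ ht h1 h2 hne
    have hx1 : |(x 0).1| ≤ ‖x 0‖ := norm_fst_le (x 0)
    have hx2 : |(x 0).2| ≤ ‖x 0‖ := norm_snd_le (x 0)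
    obtain ⟨hη1, hη2⟩ := le_min_iff.1 hη
    rw [abs_of_pos h1] at hx1
    have h7 : 2 * (γ + D) * (x 0).1 ≤ ε ^ 2 := by
      have := hx1.trans hη2
      rw [le_div_iff₀ hp] at this
      linarith
    have h8 : (x 0).2 ^ 2 ≤ ε ^ 2 := by
      rw [← sq_abs (x 0).2]; exact pow_le_pow_left₀ (abs_nonneg _) (hx2.trans hη1) 2
    rw [Prod.norm_def]
    refine max_le ?_ (abs_le_of_sq_le_sq (h6.trans (max_le h7 h8)) hε.le)
    rw [Real.norm_eq_abs, abs_of_pos h3]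
    exact h5.trans (hx1.trans hη1)
  have h := hx.arc hd ht
  rcases h0 with h0 | h0
  · rcases fourth_quadrant_of_mem_C h0 with ⟨h1, h2⟩ | ⟨h1, h2⟩
    · exact key h h1 h2 hη
    · simpa using key h.neg h1 h2 (by simpa using hη)
  · rw [h.eq_zero hD hγ h0 t ⟨ht, le_rfl⟩, norm_zero]; exact hε.le

lemma LeavesUAt.of_neg {x : ℝ → ℝ × ℝ} {T : ℝ} (h : LeavesUAt (-x) T) : LeavesUAt x T := by
  obtain ⟨h1, h2, ε, hε, h3⟩ := h
  exact ⟨h1, fun t ht => neg_mem_U.1 (h2 t ht), ε, hε, fun t ht => neg_mem_C.1 (h3 t ht)⟩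

end QuasiContControl

theorem mainTheorem3 (γ D : ℝ) (hD : 0 ≤ D) (hγ : D < γ) :
    (∀ d, QuasiContControl.IsDisturbance D d →
      ∀ x₀ ∈ QuasiContControl.U \ {0},
        QuasiContControl.WellPosedFrom γ d x₀ ∧
        ∀ x, QuasiContControl.IsTrajectory γ d x → x 0 = x₀ →
          ∃ T_U : ℝ, QuasiContControl.LeavesUAt x T_U ∧
            |x₀.2| / (γ + D) ≤ T_U ∧ T_U ≤ |x₀.2| / (γ - D)) ∧
    (D ^ (3 / 2 : ℝ) + D + 1 / 2 < γ →
      (∀ d, QuasiContControl.IsDisturbance D d →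
        ∀ x₀ ∈ QuasiContControl.C ∪ {0}, QuasiContControl.WellPosedFrom γ d x₀) ∧
      QuasiContControl.ForwardInvariant γ D (QuasiContControl.C ∪ {0}) ∧
      QuasiContControl.UniformlyStableOn γ D (QuasiContControl.C ∪ {0}) ∧
      QuasiContControl.UniformlyFiniteTimeAttractiveOn γ D (QuasiContControl.C ∪ {0}) ∧
      QuasiContControl.UniformlyFiniteTimeAttractiveOn γ D Set.univ) := by
  open QuasiContControl in
  refine ⟨fun d hd x₀ hx₀ => ⟨wellPosedFrom hD hγ hd x₀, fun x hx h0 => ?_⟩,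
    fun _ => ⟨fun d hd x₀ _ => wellPosedFrom hD hγ hd x₀, forwardInvariant hD hγ,
      uniformlyStableOn hD hγ, uniformlyFiniteTimeAttractiveOn hD hγ _,
      uniformlyFiniteTimeAttractiveOn hD hγ _⟩⟩
  subst h0
  obtain ⟨hU, hne⟩ := hx₀
  rcases eq_zero_or_mem_rightHalf (x 0) with h | h | h
  · exact absurd h hne
  · have h2 := snd_nonneg_of_mem_rightHalf h hU
    obtain ⟨T, hT, hlo, hup, -⟩ := exists_leavesUAt hD hγ (fun b hb => hx.arc hd hb) h h2
    rw [abs_of_nonneg h2]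
    exact ⟨T, hT, hlo, hup⟩
  · have h2 := snd_nonneg_of_mem_rightHalf h (neg_mem_U.2 hU)
    obtain ⟨T, hT, hlo, hup, -⟩ := exists_leavesUAt hD hγ (fun b hb => (hx.arc hd hb).neg) h h2
    rw [show |(x 0).2| = ((-x) 0).2 from (abs_neg _).symm.trans (abs_of_nonneg h2)]
    exact ⟨T, hT.of_neg, hlo, hup⟩
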